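/- Let $\rho=(4/3)^{1/4}$, let $b(0)=b(1)=1$, and let $b(k)=\bigl((k-1)!\,\rho\bigr)^{1/(k-1)}$ for every integer $k\ge 2$. For a real number $d\ge 2$ let $$\gamma_d=\begin{cases} b(d)^{2/d} & \text{if } d \text{ is an integer},\\[2pt] b(\lfloor d\rfloor)^{2(\lceil d\rceil-d)/d}\; b(\lceil d\rceil)^{2(d-\lfloor d\rfloor)/d} & \text{otherwise.}\end{cases}$$ Then every finite simple graph with $m$ edges, minimum degree at least $2$ and average degree $d$ (so that $d\ge 2$) has at most $m\,\gamma_d^{\,m}$ cycles, where cycles are counted as subgraphs. -/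

import Mathlib

namespace CycleBound

/-- The set of cycles of a graph `G`, each cycle being a subgraph of `G` (so that the starting
vertex and the orientation of a closed walk around it play no role). -/
def cycles {V : Type*} (G : SimpleGraph V) : Set G.Subgraph :=
  {H | ∃ (v : V) (w : G.Walk v v), w.IsCycle ∧ w.toSubgraph = H}

/-- The number of cycles of a finite graph is not a junk value. -/
theorem cycles_finite {V : Type*} [Finite V] (G : SimpleGraph V) : (cycles G).Finite :=
  Set.toFinite _

/-- The average degree of a finite graph. -/
noncomputable def averageDegree {V : Type*} [Fintype V] (G : SimpleGraph V)
    [DecidableRel G.Adj] : ℝ :=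
  (∑ v, (G.degree v : ℝ)) / (Fintype.card V : ℝ)

/-- `ρ = (4/3)^(1/4)`. -/
noncomputable def rho : ℝ := (4 / 3 : ℝ) ^ (1 / 4 : ℝ)

/-- `b(0) = b(1) = 1` and `b(k) = ((k-1)! ρ)^(1/(k-1))` for `k ≥ 2`. -/
noncomputable def b : ℕ → ℝ
  | 0 => 1
  | 1 => 1
  | k + 2 => ((Nat.factorial (k + 1) : ℝ) * rho) ^ (1 / ((k : ℝ) + 1))

/-- `γ_d = b(d)^(2/d)` if `d` is an integer, and
`γ_d = b(⌊d⌋)^(2(⌈d⌉-d)/d) b(⌈d⌉)^(2(d-⌊d⌋)/d)` otherwise (meant for real `d ≥ 2`). -/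
noncomputable def gamma (d : ℝ) : ℝ :=
  if (⌊d⌋₊ : ℝ) = d then
    b ⌊d⌋₊ ^ (2 / d)
  else
    b ⌊d⌋₊ ^ (2 * ((⌈d⌉₊ : ℝ) - d) / d) * b ⌈d⌉₊ ^ (2 * (d - (⌊d⌋₊ : ℝ)) / d)

end CycleBound

namespace CycleBound

open Real Finset

/-! ### The sequence `b` and its logarithmic increments -/

/-! The heart is `ncard_cycles_le`: a graph has at most `m * ∏ v, b (deg v)` cycles. Since `log b`
is concave on the integers `≥ 2`, Jensen's inequality (`prod_b_degree_le`) then bounds the product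
by `γ_d ^ m`.

For the product bound, each cycle has two orientations and there are `2m` darts, so it is enough to
bound by `∏ v, b (deg v)` the closed walks that open with a given dart `(t, s)`. Delete `s`, put a
token on each of its neighbours other than `t`, and count the paths from tokens to `t`.
`tokenSum_le_potential` bounds such counts, by induction on the vertex set, by a product of values
of `b` at (free edges + tokens), times a `weight` of the number of tokens and a power of `ρ`. An
edge lost by deleting a path end is replaced by a token, so the arguments of `b` do not change. A
lone token with only one way on is slid along; the factor `b 2 = ρ` of the vertex left behind makes
the token "long". In all other cases the paths from each token vertex are bounded separately by
induction, and what remains is the purely numerical inequality `sum_cost_le`.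

That inequality has a product over vertices on one side and a sum on the other. Replacing `exp` by a
tangent line splits it into one condition `Tame` per vertex. The sequence `tangent`, and with it
`weight`, is built to make these conditions hold. They fail only for few tokens-to-edges patterns;
`linear_or_removable` shows that such a vertex either carries all tokens and satisfies the
inequality directly, or can be handled by removing one token. -/

theorem rho_pos : 0 < rho := by unfold rho; positivity

theorem log_rho : log rho = (2 * log 2 - log 3) / 4 := by
  unfold rho
  rw [log_rpow (by norm_num), log_div (by norm_num) (by norm_num),
    show (4 : ℝ) = 2 ^ 2 by norm_num, log_pow]
  push_cast
  ring

theorem b_pos (n : ℕ) : 0 < b n := by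
  match n with
  | 0 => simp [b]
  | 1 => simp [b]
  | k + 2 =>
    have := rho_pos
    simp only [b]
    positivity

theorem mul_log_b_succ (n : ℕ) (hn : 1 ≤ n) :
    (n : ℝ) * log (b (n + 1)) = log (n.factorial : ℝ) + log rho := by
  obtain ⟨k, rfl⟩ := Nat.exists_eq_add_of_le' hn
  have h1 : (0 : ℝ) < ((k + 1).factorial : ℝ) := by exact_mod_cast Nat.factorial_pos _
  simp only [b]
  rw [log_rpow (mul_pos h1 rho_pos), log_mul h1.ne' rho_pos.ne']
  push_cast
  field_simp

/-- The logarithmic increments of `b`. -/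
noncomputable def step (n : ℕ) : ℝ := log (b (n + 1)) - log (b n)

/-- The amount by which `step n` falls short of `1 / n`. -/
noncomputable def defect (n : ℕ) : ℝ := 1 / n - step n

theorem b_succ (n : ℕ) : b (n + 1) = b n * exp (step n) := by
  rw [step, exp_sub, exp_log (b_pos _), exp_log (b_pos _)]
  have := (b_pos n).ne'
  field_simp

/-- Subtracting two consecutive cases of `mul_log_b_succ` cancels `log rho` and leaves `n log b(n+1)
- (n-1) log b(n) = log n`. It starts at `2` because `b 1` is not given by the factorial formula. -/
theorem mul_step (n : ℕ) (hn : 2 ≤ n) : n * step n = log n - log (b n) := by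
  obtain ⟨k, rfl⟩ := Nat.exists_eq_add_of_le' hn
  have h1 := mul_log_b_succ (k + 2) (by omega)
  have h2 := mul_log_b_succ (k + 1) (by omega)
  rw [Nat.factorial_succ (k + 1)] at h1
  push_cast at h1 h2 ⊢
  rw [log_mul (by positivity) (by positivity)] at h1
  have e : k + 1 + 1 = k + 2 := rfl
  rw [e] at h1 h2
  rw [show (k : ℝ) + 1 + 1 = k + 2 by ring] at h1
  rw [step]
  linarith

theorem b_mul_exp (n : ℕ) (hn : 2 ≤ n) : b n * exp (n * step n) = n := by
  have : (0 : ℝ) < n := by positivity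
  rw [mul_step n hn, exp_sub, exp_log this, exp_log (b_pos n)]
  have := (b_pos n).ne'
  field_simp

/-- Eliminates `b` from consecutive cases of `mul_step`. Together with `step_two` this recursion
drives all estimates of `step`. -/
theorem step_rec (n : ℕ) (hn : 2 ≤ n) :
    ((n : ℝ) + 1) * step (n + 1) = (n - 1) * step n + log (1 + 1 / n) := by
  have h1 := mul_step n hn
  have h2 := mul_step (n + 1) (by omega)
  have hn0 : (0 : ℝ) < n := by positivity
  have h3 : log (1 + 1 / (n : ℝ)) = log (n + 1) - log n := by
    rw [← log_div (by positivity) hn0.ne']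
    congr 1
    field_simp
  rw [h3]
  push_cast at h2
  rw [h2]
  have h4 : step n = log (b (n + 1)) - log (b n) := rfl
  linarith

theorem log_b_two : log (b 2) = log rho := by
  have := mul_log_b_succ 1 le_rfl
  simpa using this

theorem step_one : step 1 = log rho := by
  rw [step, log_b_two]; simp [b]

theorem step_two : step 2 = (log 2 - log rho) / 2 := by
  have := mul_step 2 le_rfl
  rw [log_b_two] at this
  push_cast at this
  linarith

theorem one_div_succ_le_log (n : ℕ) (hn : 1 ≤ n) : 1 / ((n : ℝ) + 1) ≤ log (1 + 1 / n) := by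
  have hn0 : (0 : ℝ) < n := by positivity
  have h := one_sub_inv_le_log_of_pos (x := 1 + 1 / (n : ℝ)) (by positivity)
  refine le_trans (le_of_eq ?_) h
  field_simp
  ring

theorem log_le_one_div (n : ℕ) (hn : 1 ≤ n) : log (1 + 1 / (n : ℝ)) ≤ 1 / n := by
  have hn0 : (0 : ℝ) < n := by positivity
  have h := log_le_sub_one_of_pos (x := 1 + 1 / (n : ℝ)) (by positivity)
  linarith

theorem log_rho_gt : 0.071920 < log rho := by
  rw [log_rho]; linarith [log_two_gt_d9, log_three_lt_d9]

theorem log_rho_lt : log rho < 0.071921 := by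
  rw [log_rho]; linarith [log_two_lt_d9, log_three_gt_d9]

/-- By `step_rec`, the first bound is equivalent to `step (n + 1) ≤ step n`, that is, to concavity
of `log b`. It propagates because `log (1 + 1 / n)` decreases. -/
theorem half_log_le_step (n : ℕ) (hn : 2 ≤ n) :
    log (1 + 1 / (n : ℝ)) / 2 ≤ step n ∧ log (1 + 1 / (n : ℝ)) / 2 ≤ step (n + 1) := by
  have key : ∀ n : ℕ, 2 ≤ n → log (1 + 1 / (n : ℝ)) / 2 ≤ step n →
      log (1 + 1 / (n : ℝ)) / 2 ≤ step (n + 1) := by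
    intro n hn h
    have hr := step_rec n hn
    have hn0 : (2 : ℝ) ≤ n := by exact_mod_cast hn
    have : ((n : ℝ) + 1) * (log (1 + 1 / (n : ℝ)) / 2) ≤ (n + 1) * step (n + 1) := by
      rw [hr]
      nlinarith [mul_le_mul_of_nonneg_left h (by linarith : (0 : ℝ) ≤ n - 1)]
    exact le_of_mul_le_mul_left this (by linarith)
  have base : ∀ n : ℕ, 2 ≤ n → log (1 + 1 / (n : ℝ)) / 2 ≤ step n := by
    intro n hn
    induction n, hn using Nat.le_induction with
    | base =>
      rw [step_two]
      have : log (1 + 1 / ((2 : ℕ) : ℝ)) = log 3 - log 2 := by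
        rw [← log_div (by norm_num) (by norm_num)]; norm_num
      rw [this]
      linarith [log_rho_lt, log_two_gt_d9, log_three_lt_d9]
    | succ n hn ih =>
      refine le_trans ?_ (key n hn ih)
      have hn0 : (0 : ℝ) < n := by positivity
      gcongr
      simp
  exact ⟨base n hn, key n hn (base n hn)⟩

theorem step_pos (n : ℕ) (hn : 1 ≤ n) : 0 < step n := by
  rcases hn.eq_or_lt with rfl | h
  · rw [step_one]; linarith [log_rho_gt]
  · refine lt_of_lt_of_le ?_ (half_log_le_step n h).1
    have hn0 : (0 : ℝ) < n := by positivity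
    have : 0 < 1 / (n : ℝ) := by positivity
    have := log_pos (x := 1 + 1 / (n : ℝ)) (by linarith)
    linarith

theorem step_succ_le (n : ℕ) (hn : 2 ≤ n) : step (n + 1) ≤ step n := by
  have hr := step_rec n hn
  have h := (half_log_le_step n hn).1
  have hn0 : (2 : ℝ) ≤ n := by exact_mod_cast hn
  have : ((n : ℝ) + 1) * step (n + 1) ≤ (n + 1) * step n := by
    rw [hr]; linarith
  exact le_of_mul_le_mul_left this (by linarith)

theorem step_le_step {n k : ℕ} (hn : 2 ≤ n) (h : n ≤ k) : step k ≤ step n := by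
  induction k, h using Nat.le_induction with
  | base => exact le_rfl
  | succ k hk ih => exact (step_succ_le k (hn.trans hk)).trans ih

/-- By `step_rec`, equivalent to `defect (n + 1) ≤ defect n`. -/
theorem two_mul_step_le (n : ℕ) (hn : 2 ≤ n) : 2 * step n ≤ 1 / n + log (1 + 1 / (n : ℝ)) := by
  induction n, hn using Nat.le_induction with
  | base =>
    rw [step_two]
    have : log (1 + 1 / ((2 : ℕ) : ℝ)) = log 3 - log 2 := by
      rw [← log_div (by norm_num) (by norm_num)]; norm_num
    rw [this]
    norm_num
    linarith [log_rho_gt, log_two_lt_d9, log_three_gt_d9]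
  | succ n hn ih =>
    have hr := step_rec n hn
    have hn0 : (2 : ℝ) ≤ n := by exact_mod_cast hn
    have hn1 : (0 : ℝ) < n := by linarith
    have hlog : log (1 + 1 / (n : ℝ)) - log (1 + 1 / ((n : ℝ) + 1)) ≤ 1 / (n * (n + 2)) := by
      rw [← log_div (by positivity) (by positivity)]
      refine (log_le_sub_one_of_pos (by positivity)).trans (le_of_eq ?_)
      field_simp
      ring
    push_cast
    have h1 : ((n : ℝ) + 1) * (2 * step (n + 1)) ≤
        (n + 1) * (1 / (n + 1) + log (1 + 1 / ((n : ℝ) + 1))) := by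
      have e : ((n : ℝ) + 1) * (1 / (n + 1) + log (1 + 1 / ((n : ℝ) + 1)))
          = 1 + (n + 1) * log (1 + 1 / ((n : ℝ) + 1)) := by field_simp
      rw [e]
      have e2 : (n - 1) * (2 * step n) ≤ (n - 1) * (1 / n + log (1 + 1 / (n : ℝ))) :=
        mul_le_mul_of_nonneg_left ih (by linarith)
      have e3 : ((n : ℝ) + 1) * (log (1 + 1 / (n : ℝ)) - log (1 + 1 / ((n : ℝ) + 1))) ≤
          (n + 1) * (1 / (n * (n + 2))) := mul_le_mul_of_nonneg_left hlog (by linarith)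
      have e4 : ((n : ℝ) + 1) * (1 / (n * (n + 2))) ≤ 1 / n := by
        rw [mul_one_div, div_le_div_iff₀ (by positivity) (by positivity)]
        nlinarith
      have e5 : ((n : ℝ) - 1) * (1 / n) = 1 - 1 / n := by field_simp
      nlinarith
    exact le_of_mul_le_mul_left h1 (by linarith)

theorem defect_succ_le (n : ℕ) (hn : 2 ≤ n) : defect (n + 1) ≤ defect n := by
  have hr := step_rec n hn
  have h := two_mul_step_le n hn
  have hn0 : (2 : ℝ) ≤ n := by exact_mod_cast hn
  have hn1 : (0 : ℝ) < n := by linarith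
  unfold defect
  push_cast
  have : ((n : ℝ) + 1) * (1 / (n + 1) - step (n + 1)) ≤ (n + 1) * (1 / n - step n) := by
    have e1 : ((n : ℝ) + 1) * (1 / (n + 1) - step (n + 1)) = 1 - (n + 1) * step (n + 1) := by
      field_simp
    have e2 : ((n : ℝ) + 1) * (1 / n - step n) = 1 + 1 / n - (n + 1) * step n := by
      field_simp
    rw [e1, e2, hr]
    linarith
  exact le_of_mul_le_mul_left this (by linarith)

theorem defect_le_defect {n k : ℕ} (hn : 2 ≤ n) (h : n ≤ k) : defect k ≤ defect n := by
  induction k, h using Nat.le_induction with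
  | base => exact le_rfl
  | succ k hk ih => exact (defect_succ_le k (hn.trans hk)).trans ih

theorem step_sub_le {n k : ℕ} (hn : 2 ≤ n) (h : n ≤ k) :
    step n - step k ≤ 1 / n - 1 / k := by
  have := defect_le_defect hn h
  unfold defect at this
  linarith

theorem step_le_one_div (n : ℕ) (hn : 2 ≤ n) : step n ≤ 1 / n := by
  have h1 := two_mul_step_le n hn
  have h2 := log_le_one_div n (by omega)
  linarith

theorem defect_nonneg (n : ℕ) (hn : 2 ≤ n) : 0 ≤ defect n := by
  have := step_le_one_div n hn
  unfold defect; linarith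

/-- `3/5` is the least constant for which the argument of `defect_le_step_succ` works at `n = 2`,
and it lies just below `2 * step 2 ≈ 0.621`. -/
theorem three_fifths_le (n : ℕ) (hn : 2 ≤ n) : 3 / 5 ≤ n * step n := by
  induction n, hn using Nat.le_induction with
  | base =>
    rw [step_two]; push_cast
    linarith [log_rho_lt, log_two_gt_d9]
  | succ n hn ih =>
    have hr := step_rec n hn
    push_cast
    rw [hr]
    have hn0 : (2 : ℝ) ≤ n := by exact_mod_cast hn
    have h1 : 2 / (2 * (n : ℝ) + 1) ≤ log (1 + 1 / n) := by
      refine le_trans (le_of_eq ?_) (le_log_one_add_of_nonneg (x := 1 / (n : ℝ)) (by positivity))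
      field_simp
      ring
    have h2 : (3 / 5 : ℝ) / n ≤ step n := by
      rw [div_le_iff₀ (by linarith)]; linarith
    have h3 : ((n : ℝ) - 1) * ((3 / 5 : ℝ) / n) ≤ (n - 1) * step n :=
      mul_le_mul_of_nonneg_left h2 (by linarith)
    have h4 : (3 / 5 : ℝ) ≤ (n - 1) * ((3 / 5 : ℝ) / n) + 2 / (2 * n + 1) := by
      have : (n - 1) * ((3 / 5 : ℝ) / n) + 2 / (2 * n + 1) - 3 / 5
          = (4 * n - 3) / (5 * n * (2 * n + 1)) := by
        field_simp; ring
      have h5 : 0 ≤ (4 * (n : ℝ) - 3) / (5 * n * (2 * n + 1)) :=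
        div_nonneg (by linarith) (by positivity)
      linarith
    linarith

/-! ### The weight of the current end vertex -/

/-- The increment of `tangent` relative to its value. -/
noncomputable def growth (n : ℕ) : ℝ := (n + 1) * (defect n - defect (n + 1))

/-- The slope at `r` of the tangent by which the token inequality is linearised. -/
noncomputable def tangent : ℕ → ℝ
  | 0 => 1
  | 1 => 1
  -- This normalisation makes `weight 2 = b 3`, an equality case of `weight_le_b_succ`.
  | 2 => 2 * b 3 / b 2
  -- The recursion makes `tangent_le` an equality when its first index is one more than the second.
  | n + 3 => tangent (n + 2) * (1 + growth (n + 2))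

/-- The weight of a path end at a vertex with `n` free edges. -/
noncomputable def weight : ℕ → ℝ
  | 0 => 1
  | 1 => 1
  | n + 2 => tangent (n + 2) * b (n + 2) / ((n : ℝ) + 2)

theorem tangent_succ (n : ℕ) (hn : 2 ≤ n) : tangent (n + 1) = tangent n * (1 + growth n) := by
  obtain ⟨k, rfl⟩ := Nat.exists_eq_add_of_le' hn
  rfl

theorem weight_eq (n : ℕ) (hn : 2 ≤ n) : weight n = tangent n * b n / n := by
  obtain ⟨k, rfl⟩ := Nat.exists_eq_add_of_le' hn
  simp [weight]

theorem growth_nonneg (n : ℕ) (hn : 2 ≤ n) : 0 ≤ growth n :=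
  mul_nonneg (by positivity) (sub_nonneg.2 (defect_succ_le n hn))

theorem growth_le (n : ℕ) (hn : 2 ≤ n) : growth n ≤ 1 / n := by
  have h := step_succ_le n hn
  have hn0 : (2 : ℝ) ≤ n := by exact_mod_cast hn
  unfold growth defect
  push_cast
  have e : ((n : ℝ) + 1) * (1 / n - step n - (1 / (n + 1) - step (n + 1)))
      = 1 / n - (n + 1) * (step n - step (n + 1)) := by
    field_simp; ring
  rw [e]
  nlinarith

theorem growth_eq (n : ℕ) (hn : 2 ≤ n) : growth n = 1 / n - 2 * step n + log (1 + 1 / (n : ℝ)) := by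
  have h := step_rec n hn
  have hn0 : (2 : ℝ) ≤ n := by exact_mod_cast hn
  unfold growth defect
  push_cast
  have e : ((n : ℝ) + 1) * (1 / n - step n - (1 / (n + 1) - step (n + 1)))
      = 1 / n - (n + 1) * step n + (n + 1) * step (n + 1) := by
    field_simp; ring
  rw [e, h]
  ring

theorem tangent_pos (n : ℕ) (hn : 2 ≤ n) : 0 < tangent n := by
  induction n, hn using Nat.le_induction with
  | base =>
    have := b_pos 3
    have := b_pos 2
    simp only [tangent]; positivity
  | succ n hn ih =>
    rw [tangent_succ n hn]
    have := growth_nonneg n hn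
    positivity

/-- In the induction the cross term `growth n * n * (defect r - defect n)` is absorbed because `n *
growth n ≤ 1`. -/
theorem tangent_le_of_le {r n : ℕ} (hr : 2 ≤ r) (h : r ≤ n) :
    tangent n ≤ tangent r * (1 + n * (defect r - defect n)) := by
  induction n, h using Nat.le_induction with
  | base => simp
  | succ n hn ih =>
    have h2 := hr.trans hn
    rw [tangent_succ n h2]
    have hg := growth_nonneg n h2
    have hg2 := growth_le n h2
    have hd := defect_le_defect hr hn
    have hn0 : (2 : ℝ) ≤ n := by exact_mod_cast h2
    have ht := (tangent_pos r hr).le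
    have e1 : tangent n * (1 + growth n) ≤
        tangent r * (1 + n * (defect r - defect n)) * (1 + growth n) :=
      mul_le_mul_of_nonneg_right ih (by linarith)
    refine e1.trans ?_
    rw [mul_assoc]
    refine mul_le_mul_of_nonneg_left ?_ ht
    push_cast
    have e2 : growth n * n ≤ 1 := by
      rw [le_div_iff₀ (by linarith)] at hg2; exact hg2
    have e3 : growth n * n * (defect r - defect n) ≤ 1 * (defect r - defect n) :=
      mul_le_mul_of_nonneg_right e2 (by linarith)
    have e4 : growth n = (n + 1) * (defect n - defect (n + 1)) := rfl
    nlinarith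

theorem tangent_le_of_ge {n r : ℕ} (hn : 2 ≤ n) (h : n ≤ r) :
    tangent n ≤ tangent r * (1 - n * (defect n - defect r)) := by
  revert hn
  induction h using Nat.decreasingInduction with
  | self => simp
  | of_succ n hlt ih =>
    intro hn
    have ih := ih (by omega)
    rw [tangent_succ n hn] at ih
    have hg := growth_nonneg n hn
    have hg2 := growth_le n hn
    have hd := defect_le_defect (n := n + 1) (by omega) (Nat.succ_le_of_lt hlt)
    have hn0 : (2 : ℝ) ≤ n := by exact_mod_cast hn
    have ht := (tangent_pos r (by omega)).le
    have hpos : 0 < 1 + growth n := by linarith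
    refine le_of_mul_le_mul_right (ih.trans ?_) hpos
    rw [mul_assoc]
    refine mul_le_mul_of_nonneg_left ?_ ht
    push_cast
    have e2 : growth n * n ≤ 1 := by
      rw [le_div_iff₀ (by linarith)] at hg2; exact hg2
    set x := defect n - defect (n + 1) with hx
    set y := defect (n + 1) - defect r with hy
    have e4 : growth n = (n + 1) * x := rfl
    have e5 : defect n - defect r = x + y := by rw [hx, hy]; ring
    have hy0 : 0 ≤ y := by rw [hy]; linarith
    have hx0 : 0 ≤ x := by rw [hx]; linarith [defect_succ_le n hn]
    rw [e5]
    have e6 : growth n * n * (x + y) ≤ 1 * (x + y) :=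
      mul_le_mul_of_nonneg_right e2 (by linarith)
    nlinarith

/-- The linearisation at `r` bounds all values. -/
theorem tangent_le {n r : ℕ} (hn : 2 ≤ n) (hr : 2 ≤ r) :
    tangent n ≤ tangent r * (1 + n * (defect r - defect n)) := by
  rcases le_total r n with h | h
  · exact tangent_le_of_le hr h
  · refine (tangent_le_of_ge hn h).trans (le_of_eq ?_)
    ring

theorem tangent_div_le {n r : ℕ} (hn : 2 ≤ n) (hr : 2 ≤ r) :
    tangent n / n ≤ tangent r * (defect r + step n) := by
  have h := tangent_le hn hr
  have hn0 : (2 : ℝ) ≤ n := by exact_mod_cast hn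
  rw [div_le_iff₀ (by linarith)]
  refine h.trans (le_of_eq ?_)
  unfold defect
  field_simp
  ring

theorem weight_pos (n : ℕ) : 0 < weight n := by
  match n with
  | 0 => simp [weight]
  | 1 => simp [weight]
  | n + 2 =>
    have := tangent_pos (n + 2) (by omega)
    have := b_pos (n + 2)
    simp only [weight]; positivity

/-- Hence `G ↦ weight r * exp G` has value and slope `tangent r` at `G = r * step r`, the point
where the token inequality is linearised. -/
theorem weight_mul_exp (n : ℕ) (hn : 2 ≤ n) : weight n * exp (n * step n) = tangent n := by
  rw [weight_eq n hn, div_mul_eq_mul_div, mul_assoc, b_mul_exp n hn]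
  have : (0 : ℝ) < n := by positivity
  field_simp

theorem weight_div_b (n : ℕ) (hn : 2 ≤ n) : weight n / b n = tangent n / n := by
  rw [weight_eq n hn]
  have := (b_pos n).ne'
  field_simp

theorem weight_succ (n : ℕ) (hn : 2 ≤ n) :
    weight (n + 1) = weight n * ((1 + growth n) * exp (defect n - growth n)) := by
  have h1 := weight_mul_exp n hn
  have h2 := weight_mul_exp (n + 1) (by omega)
  rw [tangent_succ n hn, ← h1] at h2
  have hn0 : (2 : ℝ) ≤ n := by exact_mod_cast hn
  have e : defect n - growth n = n * step n - ((n + 1 : ℕ) : ℝ) * step (n + 1) := by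
    unfold growth defect
    push_cast
    field_simp; ring
  rw [e, exp_sub]
  have := exp_pos (((n + 1 : ℕ) : ℝ) * step (n + 1))
  field_simp
  linarith

theorem growth_le_two_mul_defect (n : ℕ) (hn : 2 ≤ n) : growth n ≤ 2 * defect n := by
  rw [growth_eq n hn]
  have := log_le_one_div n (by omega)
  unfold defect
  linarith

theorem weight_two : weight 2 = b 3 := by
  have h2 := (b_pos 2).ne'
  simp only [weight, tangent]; field_simp; norm_num; ring

/-- For `n ≥ 2` the ratio is `(1 + z) * exp (d - z) ≥ 1 + d + z * d - z ^ 2`, and `z ^ 2 ≤ z / 2 ≤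
d`. -/
theorem weight_le_succ (n : ℕ) : weight n ≤ weight (n + 1) := by
  match n with
  | 0 => simp [weight]
  | 1 =>
    rw [weight_two]
    simp only [weight]
    have h3 := b_succ 1
    have h4 := b_succ 2
    have e1 := one_le_exp (step_pos 1 le_rfl).le
    have e2 := one_le_exp (step_pos 2 (by omega)).le
    rw [h4, h3]
    simp only [b, one_mul]
    nlinarith
  | k + 2 =>
    have hn : 2 ≤ k + 2 := by omega
    rw [weight_succ _ hn]
    refine le_mul_of_one_le_right (weight_pos _).le ?_
    have hg := growth_nonneg _ hn
    have hg2 := growth_le _ hn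
    have hg3 := growth_le_two_mul_defect _ hn
    have hd := defect_nonneg _ hn
    set z := growth (k + 2)
    set d := defect (k + 2)
    have hz : z ≤ 1 / 2 := by
      refine hg2.trans ?_
      gcongr
      push_cast; linarith [(Nat.cast_nonneg k : (0 : ℝ) ≤ k)]
    have e := add_one_le_exp (d - z)
    have : (1 + z) * (d - z + 1) ≤ (1 + z) * exp (d - z) :=
      mul_le_mul_of_nonneg_left e (by linarith)
    nlinarith

theorem weight_mono : Monotone weight := monotone_nat_of_le_succ weight_le_succ

theorem one_le_weight (n : ℕ) : 1 ≤ weight n := by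
  have := weight_mono (Nat.zero_le n)
  simpa [weight] using this

theorem defect_le_step_succ (n : ℕ) (hn : 2 ≤ n) : defect n ≤ step (n + 1) := by
  have h1 := three_fifths_le n hn
  have h2 := three_fifths_le (n + 1) (by omega)
  have hn0 : (2 : ℝ) ≤ n := by exact_mod_cast hn
  push_cast at h2
  unfold defect
  have h3 : (3 / 5 : ℝ) / n ≤ step n := by
    rw [div_le_iff₀ (by linarith)]; linarith
  have h4 : (3 / 5 : ℝ) / (n + 1) ≤ step (n + 1) := by
    rw [div_le_iff₀ (by linarith)]; linarith
  have h5 : 1 / (n : ℝ) ≤ (3 / 5 : ℝ) / n + (3 / 5 : ℝ) / (n + 1) := by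
    have : (3 / 5 : ℝ) / n + (3 / 5 : ℝ) / (n + 1) - 1 / n = (n - 2) / (5 * n * (n + 1)) := by
      field_simp; ring
    have h6 : 0 ≤ ((n : ℝ) - 2) / (5 * n * (n + 1)) := div_nonneg (by linarith) (by positivity)
    linarith
  linarith

/-- Settles the case of a single token, and lets the `deg s - 1` tokens around a deleted vertex `s`
be paid for by `b (deg s)`. The ratio of successive weights is at most `exp (defect n)`, that of the
right sides is `exp (step (n + 1))`. -/
theorem weight_le_b_succ (n : ℕ) (hn : 1 ≤ n) : weight n ≤ b (n + 1) := by
  induction n, hn using Nat.le_induction with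
  | base =>
    rw [b_succ 1]
    simp only [weight, b, one_mul]
    exact one_le_exp (step_pos 1 le_rfl).le
  | succ n hn ih =>
    rcases hn.eq_or_lt with rfl | hn
    · exact weight_two.le
    · rw [weight_succ n hn, b_succ (n + 1)]
      refine mul_le_mul ih ?_ ?_ (b_pos _).le
      · have hd := defect_le_step_succ n hn
        have e1 := add_one_le_exp (growth n)
        have e2 : (1 + growth n) * exp (defect n - growth n) ≤
            exp (growth n) * exp (defect n - growth n) :=
          mul_le_mul_of_nonneg_right (by linarith) (exp_pos _).le
        rw [← exp_add, add_sub_cancel] at e2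
        exact e2.trans (exp_le_exp.2 hd)
      · have := growth_nonneg n hn
        positivity

theorem b_le_succ (n : ℕ) : b n ≤ b (n + 1) := by
  rcases Nat.eq_zero_or_pos n with rfl | hn
  · simp [b]
  · rw [b_succ n]
    exact le_mul_of_one_le_right (b_pos n).le (one_le_exp (step_pos n hn).le)

theorem b_mono : Monotone b := monotone_nat_of_le_succ b_le_succ

theorem one_le_b (n : ℕ) : 1 ≤ b n := by
  have := b_mono (Nat.zero_le n)
  simpa [b] using this

/-! ### Numerical values -/

theorem log_seven_gt : 1.945909 < log 7 := by
  -- `49/48` involves only the primes `2`, `3`, `7`; for the upper bound `50/49` plays the same role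
  -- with `2`, `5`, `7`.
  have h := le_log_one_add_of_nonneg (x := 1 / 48) (by norm_num)
  have e : log (1 + 1 / 48) = 2 * log 7 - (4 * log 2 + log 3) := by
    rw [show (1 + 1 / 48 : ℝ) = 7 ^ 2 / (2 ^ 4 * 3) by norm_num,
      log_div (by norm_num) (by norm_num), log_mul (by norm_num) (by norm_num), log_pow, log_pow]
    norm_num
  rw [e] at h
  norm_num at h
  linarith [log_two_gt_d9, log_three_gt_d9]

theorem log_seven_lt : log 7 < 1.945911 := by
  have h := le_log_one_add_of_nonneg (x := 1 / 49) (by norm_num)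
  have e : log (1 + 1 / 49) = log 2 + 2 * log 5 - 2 * log 7 := by
    rw [show (1 + 1 / 49 : ℝ) = 2 * 5 ^ 2 / 7 ^ 2 by norm_num,
      log_div (by norm_num) (by norm_num), log_mul (by norm_num) (by norm_num), log_pow, log_pow]
    norm_num
  rw [e] at h
  norm_num at h
  linarith [log_two_lt_d9, log_five_lt_d9]

theorem log_three_halves : log (1 + 1 / ((2 : ℕ) : ℝ)) = log 3 - log 2 := by
  rw [← log_div (by norm_num) (by norm_num)]; norm_num

theorem log_four_thirds : log (1 + 1 / ((3 : ℕ) : ℝ)) = 2 * log 2 - log 3 := by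
  rw [show (1 + 1 / ((3 : ℕ) : ℝ)) = 2 ^ 2 / 3 by norm_num, log_div (by norm_num) (by norm_num),
    log_pow]
  norm_num

theorem log_five_fourths : log (1 + 1 / ((4 : ℕ) : ℝ)) = log 5 - 2 * log 2 := by
  rw [show (1 + 1 / ((4 : ℕ) : ℝ)) = 5 / 2 ^ 2 by norm_num, log_div (by norm_num) (by norm_num),
    log_pow]
  norm_num

theorem log_six_fifths : log (1 + 1 / ((5 : ℕ) : ℝ)) = log 2 + log 3 - log 5 := by
  rw [show (1 + 1 / ((5 : ℕ) : ℝ)) = 2 * 3 / 5 by norm_num, log_div (by norm_num) (by norm_num),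
    log_mul (by norm_num) (by norm_num)]

theorem log_seven_sixths : log (1 + 1 / ((6 : ℕ) : ℝ)) = log 7 - log 2 - log 3 := by
  rw [show (1 + 1 / ((6 : ℕ) : ℝ)) = 7 / 2 / 3 by norm_num, log_div (by norm_num) (by norm_num),
    log_div (by norm_num) (by norm_num)]

theorem log_eight_sevenths : log (1 + 1 / ((7 : ℕ) : ℝ)) = 3 * log 2 - log 7 := by
  rw [show (1 + 1 / ((7 : ℕ) : ℝ)) = 2 ^ 3 / 7 by norm_num, log_div (by norm_num) (by norm_num),
    log_pow]
  norm_num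

theorem log_nine_eighths : log (1 + 1 / ((8 : ℕ) : ℝ)) = 2 * log 3 - 3 * log 2 := by
  rw [show (1 + 1 / ((8 : ℕ) : ℝ)) = 3 ^ 2 / 2 ^ 3 by norm_num,
    log_div (by norm_num) (by norm_num), log_pow, log_pow]
  norm_num

theorem log_ten_ninths : log (1 + 1 / ((9 : ℕ) : ℝ)) = log 2 + log 5 - 2 * log 3 := by
  rw [show (1 + 1 / ((9 : ℕ) : ℝ)) = 2 * 5 / 3 ^ 2 by norm_num,
    log_div (by norm_num) (by norm_num), log_mul (by norm_num) (by norm_num), log_pow]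
  norm_num

theorem step_two_bounds : 0.310612 < step 2 ∧ step 2 < 0.310614 := by
  rw [step_two, log_rho]
  constructor <;> linarith [log_two_gt_d9, log_two_lt_d9, log_three_gt_d9, log_three_lt_d9]

theorem step_three_bounds : 0.238692 < step 3 ∧ step 3 < 0.238694 := by
  have h := step_rec 2 (by norm_num)
  rw [log_three_halves] at h
  norm_num at h
  obtain ⟨h1, h2⟩ := step_two_bounds
  constructor <;> linarith [log_two_gt_d9, log_two_lt_d9, log_three_gt_d9, log_three_lt_d9]

theorem step_four_bounds : 0.191265 < step 4 ∧ step 4 < 0.191268 := by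
  have h := step_rec 3 (by norm_num)
  rw [log_four_thirds] at h
  norm_num at h
  obtain ⟨h1, h2⟩ := step_three_bounds
  constructor <;> linarith [log_two_gt_d9, log_two_lt_d9, log_three_gt_d9, log_three_lt_d9]

theorem step_five_bounds : 0.159387 < step 5 ∧ step 5 < 0.159391 := by
  have h := step_rec 4 (by norm_num)
  rw [log_five_fourths] at h
  norm_num at h
  obtain ⟨h1, h2⟩ := step_four_bounds
  constructor <;> linarith [log_two_gt_d9, log_two_lt_d9, log_five_gt_d9, log_five_lt_d9]

theorem step_six_bounds : 0.136644 < step 6 ∧ step 6 < 0.136648 := by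
  have h := step_rec 5 (by norm_num)
  rw [log_six_fifths] at h
  norm_num at h
  obtain ⟨h1, h2⟩ := step_five_bounds
  constructor <;> linarith [log_two_gt_d9, log_two_lt_d9, log_five_gt_d9, log_five_lt_d9,
    log_three_gt_d9, log_three_lt_d9]

theorem step_seven_bounds : 0.119624 < step 7 ∧ step 7 < 0.119628 := by
  have h := step_rec 6 (by norm_num)
  rw [log_seven_sixths] at h
  norm_num at h
  obtain ⟨h1, h2⟩ := step_six_bounds
  constructor <;> linarith [log_two_gt_d9, log_two_lt_d9, log_seven_gt, log_seven_lt,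
    log_three_gt_d9, log_three_lt_d9]

theorem step_eight_bounds : 0.106408 < step 8 ∧ step 8 < 0.106413 := by
  have h := step_rec 7 (by norm_num)
  rw [log_eight_sevenths] at h
  norm_num at h
  obtain ⟨h1, h2⟩ := step_seven_bounds
  constructor <;> linarith [log_two_gt_d9, log_two_lt_d9, log_seven_gt, log_seven_lt]

theorem step_nine_gt : 0.095848 < step 9 := by
  have h := step_rec 8 (by norm_num)
  rw [log_nine_eighths] at h
  norm_num at h
  linarith [step_eight_bounds.1, log_two_lt_d9, log_three_gt_d9]

theorem step_ten_gt : 0.087214 < step 10 := by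
  have h := step_rec 9 (by norm_num)
  rw [log_ten_ninths] at h
  norm_num at h
  linarith [step_nine_gt, log_two_gt_d9, log_three_lt_d9, log_five_gt_d9]

theorem step_eleven_gt : 0.08 < step 11 := by
  have h := step_rec 10 (by norm_num)
  have h2 := le_log_one_add_of_nonneg (x := 1 / ((10 : ℕ) : ℝ)) (by norm_num)
  norm_num at h h2
  linarith [step_ten_gt]

theorem growth_two_gt : 0.28423 < growth 2 := by
  rw [growth_eq 2 (by norm_num), log_three_halves]
  norm_num
  linarith [step_two_bounds.2, log_two_lt_d9, log_three_gt_d9]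

theorem growth_three_gt : 0.14362 < growth 3 := by
  rw [growth_eq 3 (by norm_num), log_four_thirds]
  norm_num
  linarith [step_three_bounds.2, log_two_gt_d9, log_three_lt_d9]

theorem growth_four_gt : 0.0906 < growth 4 := by
  rw [growth_eq 4 (by norm_num), log_five_fourths]
  norm_num
  linarith [step_four_bounds.2, log_two_lt_d9, log_five_gt_d9]

theorem growth_five_gt : 0.06353 < growth 5 := by
  rw [growth_eq 5 (by norm_num), log_six_fifths]
  norm_num
  linarith [step_five_bounds.2, log_two_gt_d9, log_three_gt_d9, log_five_lt_d9]

theorem growth_six_gt : 0.04751 < growth 6 := by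
  rw [growth_eq 6 (by norm_num), log_seven_sixths]
  norm_num
  linarith [step_six_bounds.2, log_two_lt_d9, log_three_lt_d9, log_seven_gt]

theorem b_pow (n : ℕ) (hn : 1 ≤ n) : b (n + 1) ^ n = n.factorial * rho := by
  have h := mul_log_b_succ n hn
  have h1 : (0 : ℝ) < (n.factorial : ℝ) := by exact_mod_cast Nat.factorial_pos _
  rw [← log_pow, ← log_mul h1.ne' rho_pos.ne'] at h
  exact log_injOn_pos (Set.mem_Ioi.2 (pow_pos (b_pos _) _)) (Set.mem_Ioi.2 (mul_pos h1 rho_pos)) h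

theorem rho_pow : rho ^ 4 = 4 / 3 := by
  unfold rho
  rw [← rpow_natCast, ← rpow_mul (by norm_num)]
  norm_num

theorem rho_gt : 1.07456 < rho := by
  refine lt_of_pow_lt_pow_left₀ 4 rho_pos.le ?_
  rw [rho_pow]; norm_num

theorem rho_lt : rho < 1.07458 := by
  refine lt_of_pow_lt_pow_left₀ 4 (by norm_num) ?_
  rw [rho_pow]; norm_num

theorem lt_b_succ {q : ℝ} (n : ℕ) (hn : 1 ≤ n) (h : q ^ n < n.factorial * 1.07456) :
    q < b (n + 1) := by
  refine lt_of_pow_lt_pow_left₀ n (b_pos _).le ?_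
  rw [b_pow n hn]
  refine h.trans ?_
  have h1 : (0 : ℝ) < (n.factorial : ℝ) := by exact_mod_cast Nat.factorial_pos _
  exact mul_lt_mul_of_pos_left rho_gt h1

theorem b_succ_lt {q : ℝ} (hq : 0 ≤ q) (n : ℕ) (hn : 1 ≤ n) (h : n.factorial * 1.07458 < q ^ n) :
    b (n + 1) < q := by
  refine lt_of_pow_lt_pow_left₀ n hq ?_
  rw [b_pow n hn]
  refine lt_trans ?_ h
  have h1 : (0 : ℝ) < (n.factorial : ℝ) := by exact_mod_cast Nat.factorial_pos _
  exact mul_lt_mul_of_pos_left rho_lt h1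

theorem b_two : b 2 = rho := by
  simpa using b_pow 1 le_rfl

theorem b_three_gt : 1.4659 < b 3 := lt_b_succ 2 (by norm_num) (by norm_num [Nat.factorial])
theorem b_three_lt : b 3 < 1.4661 :=
  b_succ_lt (by norm_num) 2 (by norm_num) (by norm_num [Nat.factorial])
theorem b_four_gt : 1.8611 < b 4 := lt_b_succ 3 (by norm_num) (by norm_num [Nat.factorial])
theorem b_five_gt : 2.2534 < b 5 := lt_b_succ 4 (by norm_num) (by norm_num [Nat.factorial])
theorem b_six_gt : 2.6429 < b 6 := lt_b_succ 5 (by norm_num) (by norm_num [Nat.factorial])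
theorem b_seven_gt : 3.0298 < b 7 := lt_b_succ 6 (by norm_num) (by norm_num [Nat.factorial])
theorem b_seven_lt : b 7 < 3.0304 :=
  b_succ_lt (by norm_num) 6 (by norm_num) (by norm_num [Nat.factorial])
theorem b_eight_gt : 3.4147 < b 8 := lt_b_succ 7 (by norm_num) (by norm_num [Nat.factorial])
theorem b_eight_lt : b 8 < 3.4152 :=
  b_succ_lt (by norm_num) 7 (by norm_num) (by norm_num [Nat.factorial])
theorem b_nine_gt : 3.7981 < b 9 := lt_b_succ 8 (by norm_num) (by norm_num [Nat.factorial])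
theorem b_nine_lt : b 9 < 3.7986 :=
  b_succ_lt (by norm_num) 8 (by norm_num) (by norm_num [Nat.factorial])
theorem b_ten_gt : 4.18 < b 10 := lt_b_succ 9 (by norm_num) (by norm_num [Nat.factorial])

/-! ### Local form of the token inequality -/

/-- Logarithm of the factor by which `x` tokens at a vertex with `n` further edges raise the
potential, all tokens but one being long. -/
noncomputable def gain (n x : ℕ) : ℝ := ((x : ℝ) - 1) * log rho + (log (b (n + x)) - log (b n))

theorem gain_one (n : ℕ) : gain n 1 = step n := by simp [gain, step]

theorem gain_succ (n x : ℕ) : gain n (x + 1) = gain n x + log rho + step (n + x) := by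
  simp only [gain, step, ← add_assoc]
  push_cast
  ring

theorem exp_gain (n x : ℕ) (hx : 1 ≤ x) : exp (gain n x) = rho ^ (x - 1) * b (n + x) / b n := by
  obtain ⟨y, rfl⟩ := Nat.exists_eq_add_of_le' hx
  rw [gain, exp_add, exp_sub, exp_log (b_pos _), exp_log (b_pos _)]
  push_cast
  rw [add_sub_cancel_right, exp_nat_mul, exp_log rho_pos, mul_div_assoc]

/-- The token inequality for a single vertex, linearised at `r`. -/
def Tame (n x r : ℕ) : Prop :=
  (x : ℝ) * (weight n / b n) ≤ tangent r * (x * defect r + gain n x)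

/-- A criterion that does not depend on `r`: `tangent_div_le` has already compared `n` with every
`r`. -/
theorem tame_of_mul_step_le {n x r : ℕ} (hn : 2 ≤ n) (hr : 2 ≤ r)
    (h : x * step n ≤ gain n x) : Tame n x r := by
  have h1 := tangent_div_le hn hr
  have ht := tangent_pos r hr
  unfold Tame
  rw [weight_div_b n hn]
  calc (x : ℝ) * (tangent n / n) ≤ x * (tangent r * (defect r + step n)) := by gcongr
    _ = tangent r * (x * defect r + x * step n) := by ring
    _ ≤ _ := by gcongr

/-- Each further token adds `log rho + step (n + x)` to the gain; as `step` decreases, the last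
increment is the worst. -/
theorem mul_step_le_gain {n x : ℕ} (hn : 2 ≤ n) (hx : 1 ≤ x)
    (h : step n - step (n + x - 1) ≤ log rho) : x * step n ≤ gain n x := by
  induction x, hx using Nat.le_induction with
  | base => simp [gain_one]
  | succ x hx ih =>
    have e : n + (x + 1) - 1 = n + x := by omega
    rw [e] at h
    have h2 := step_le_step (n := n + x - 1) (k := n + x) (by omega) (by omega)
    have ih := ih (by linarith)
    rw [gain_succ]
    push_cast
    linarith

/-- Since `(r + 1) * (defect (r + 1) + step (r + 1)) = 1`, the growth of `tangent` outweighs the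
drop of `defect` as soon as `K ≥ step (r + 1)`. So `Tame` at one `r₀` passes to all larger `r`. -/
theorem tangent_mul_mono {K : ℝ} {r₀ r : ℕ} (h2 : 2 ≤ r₀) (hr : r₀ ≤ r) (hK : step (r₀ + 1) ≤ K) :
    tangent r₀ * (defect r₀ + K) ≤ tangent r * (defect r + K) := by
  induction r, hr using Nat.le_induction with
  | base => exact le_rfl
  | succ r hr ih =>
    refine ih.trans ?_
    have h2r := h2.trans hr
    rw [tangent_succ r h2r, mul_assoc]
    refine mul_le_mul_of_nonneg_left ?_ (tangent_pos r h2r).le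
    have hs := step_le_step (n := r₀ + 1) (k := r + 1) (by omega) (by omega)
    have hr0 : (2 : ℝ) ≤ r := by exact_mod_cast h2r
    have hd := defect_succ_le r h2r
    have e : growth r = (r + 1) * (defect r - defect (r + 1)) := rfl
    have h1 : 1 ≤ (r + 1) * (defect (r + 1) + K) := by
      have : ((r : ℝ) + 1) * (defect (r + 1) + step (r + 1)) = 1 := by
        unfold defect; push_cast; field_simp; ring
      nlinarith
    have h3 : (defect r - defect (r + 1)) * 1 ≤
        (defect r - defect (r + 1)) * ((r + 1) * (defect (r + 1) + K)) :=
      mul_le_mul_of_nonneg_left h1 (by linarith)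
    rw [e]
    linarith

theorem tame_mono {n x r₀ r : ℕ} (hx : 1 ≤ x) (h2 : 2 ≤ r₀) (hr : r₀ ≤ r)
    (hK : x * step (r₀ + 1) ≤ gain n x) (h : Tame n x r₀) : Tame n x r := by
  have hx0 : (0 : ℝ) < x := by positivity
  have hK' : step (r₀ + 1) ≤ gain n x / x := by
    rw [le_div_iff₀ hx0]; linarith
  have := tangent_mul_mono h2 hr hK'
  unfold Tame at *
  have e : ∀ s : ℕ, tangent s * (x * defect s + gain n x)
      = x * (tangent s * (defect s + gain n x / x)) := by
    intro s; field_simp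
  rw [e] at h ⊢
  exact h.trans (mul_le_mul_of_nonneg_left this hx0.le)

/-- A criterion for `Tame` in terms of the ratio of tangents. -/
theorem tame_of_ratio {n x r : ℕ} {q : ℝ} (hn : 2 ≤ n) (hq : q * tangent n ≤ tangent r)
    (hpos : 0 ≤ x * defect r + gain n x) (h : (x : ℝ) / n ≤ q * (x * defect r + gain n x)) :
    Tame n x r := by
  unfold Tame
  rw [weight_div_b n hn]
  have ht := tangent_pos n hn
  calc (x : ℝ) * (tangent n / n) = tangent n * ((x : ℝ) / n) := by ring
    _ ≤ tangent n * (q * (x * defect r + gain n x)) := by gcongr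
    _ = q * tangent n * (x * defect r + gain n x) := by ring
    _ ≤ _ := by gcongr

/-- The inequality for a single vertex carrying all tokens. -/
def Alone (n x : ℕ) : Prop := x * weight n ≤ weight x * (rho ^ (x - 1) * b (n + x))

/-- The condition under which the inequality for `x - 1` tokens implies that for `x` tokens. -/
def Removable (n x : ℕ) : Prop :=
  weight n ≤ weight (x - 1) * (rho ^ (x - 2) * (rho * b (n + x) - b (n + x - 1)))

theorem rho_gt_one : 1 < rho := lt_trans (by norm_num) rho_gt

theorem four_fifths_le (n : ℕ) (hn : 6 ≤ n) : 4 / 5 ≤ n * step n := by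
  induction n, hn using Nat.le_induction with
  | base => push_cast; linarith [step_six_bounds.1]
  | succ n hn ih =>
    have hr := step_rec n (by omega)
    push_cast
    rw [hr]
    have hn0 : (6 : ℝ) ≤ n := by exact_mod_cast hn
    have h1 := one_div_succ_le_log n (by omega)
    have h2 : (4 / 5 : ℝ) / n ≤ step n := by
      rw [div_le_iff₀ (by linarith)]; linarith
    have h3 : ((n : ℝ) - 1) * ((4 / 5 : ℝ) / n) ≤ (n - 1) * step n :=
      mul_le_mul_of_nonneg_left h2 (by linarith)
    have h4 : (4 / 5 : ℝ) ≤ (n - 1) * ((4 / 5 : ℝ) / n) + 1 / (n + 1) := by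
      have : (n - 1) * ((4 / 5 : ℝ) / n) + 1 / (n + 1) - 4 / 5
          = (n - 4) / (5 * n * (n + 1)) := by
        field_simp; ring
      have h5 : 0 ≤ ((n : ℝ) - 4) / (5 * n * (n + 1)) :=
        div_nonneg (by linarith) (by positivity)
      linarith
    linarith

theorem removable_of_le {n x : ℕ} (hx : 8 ≤ x) (hnx : n < x) (h10 : 10 ≤ n + x) :
    Removable n x := by
  have hw : weight n ≤ weight (x - 1) := weight_mono (by omega)
  have hN : n + x = n + x - 1 + 1 := by omega
  unfold Removable
  refine hw.trans (le_mul_of_one_le_right (weight_pos _).le ?_)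
  have h1 : 1.5395 < rho ^ 6 := by
    have := pow_lt_pow_left₀ rho_gt (by norm_num) (n := 6) (by norm_num)
    refine lt_trans (by norm_num) this
  have h2 : rho ^ 6 ≤ rho ^ (x - 2) := pow_le_pow_right₀ rho_gt_one.le (by omega)
  have h3 : 4.18 < b (n + x) := b_ten_gt.trans_le (b_mono h10)
  -- With `L = M * step M` in `[4/5, 1]` the increment of `b` is at least `b M * step M = L * exp
  -- (-L)`, which is close to `1/e`.
  have h4 : 0.353 ≤ b (n + x) - b (n + x - 1) := by
    rw [hN, b_succ (n + x - 1), Nat.add_sub_cancel]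
    set M := n + x - 1
    have hM : 6 ≤ M := by omega
    have hL := four_fifths_le M hM
    have hL1 : M * step M ≤ 1 := by
      have := step_le_one_div M (by omega)
      have hM0 : (0 : ℝ) < M := by positivity
      rwa [le_div_iff₀ hM0, mul_comm] at this
    have hb := b_mul_exp M (by omega)
    have hM0 : (0 : ℝ) < M := by positivity
    have e1 : b M = M * exp (-(M * step M)) := by
      rw [exp_neg, ← div_eq_mul_inv, eq_div_iff (exp_pos _).ne']; exact hb
    have e2 := add_one_le_exp (step M)
    have e3 : b M * step M ≤ b M * exp (step M) - b M := by
      nlinarith [b_pos M]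
    refine le_trans ?_ e3
    rw [e1, mul_right_comm]
    set L := M * step M
    have e4 : exp (-1) * (2 - L) ≤ exp (-L) := by
      have : exp (-L) = exp (-1) * exp (1 - L) := by rw [← exp_add]; congr 1; ring
      rw [this]
      have := add_one_le_exp (1 - L)
      have := exp_pos (-1)
      gcongr
      linarith
    have e5 : 0.3678 < exp (-1) := lt_trans (by norm_num) exp_neg_one_gt_d9
    have e6 : 0.96 ≤ L * (2 - L) := by nlinarith
    calc (0.353 : ℝ) ≤ 0.96 * 0.3678 := by norm_num
      _ ≤ L * (2 - L) * exp (-1) := by gcongr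
      _ = L * (exp (-1) * (2 - L)) := by ring
      _ ≤ L * exp (-L) := by gcongr
  have h5 : 0.6646 ≤ rho * b (n + x) - b (n + x - 1) := by
    have := rho_gt
    nlinarith
  calc (1 : ℝ) ≤ 1.5395 * 0.6646 := by norm_num
    _ ≤ rho ^ (x - 2) * (rho * b (n + x) - b (n + x - 1)) :=
      mul_le_mul (h1.le.trans h2) h5 (by norm_num) (pow_pos rho_pos _).le

/-! ### Numerical verification for small pairs `(n, x)`. -/

theorem tangent_three : 1.28423 * tangent 2 ≤ tangent 3 := by
  rw [tangent_succ 2 le_rfl]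
  nlinarith [growth_two_gt, tangent_pos 2 le_rfl]

theorem tangent_four : 1.14362 * tangent 3 ≤ tangent 4 := by
  rw [tangent_succ 3 (by norm_num)]
  nlinarith [growth_three_gt, tangent_pos 3 (by norm_num)]

theorem tangent_five : 1.0906 * tangent 4 ≤ tangent 5 := by
  rw [tangent_succ 4 (by norm_num)]
  nlinarith [growth_four_gt, tangent_pos 4 (by norm_num)]

theorem tangent_six : 1.06353 * tangent 5 ≤ tangent 6 := by
  rw [tangent_succ 5 (by norm_num)]
  nlinarith [growth_five_gt, tangent_pos 5 (by norm_num)]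

theorem tangent_seven : 1.04751 * tangent 6 ≤ tangent 7 := by
  rw [tangent_succ 6 (by norm_num)]
  nlinarith [growth_six_gt, tangent_pos 6 (by norm_num)]

theorem gain_values :
    gain 2 3 = 2 * log rho + step 2 + step 3 + step 4 ∧
    gain 2 4 = 3 * log rho + step 2 + step 3 + step 4 + step 5 ∧
    gain 2 5 = 4 * log rho + step 2 + step 3 + step 4 + step 5 + step 6 ∧
    gain 3 3 = 2 * log rho + step 3 + step 4 + step 5 ∧
    gain 3 4 = 3 * log rho + step 3 + step 4 + step 5 + step 6 ∧
    gain 3 5 = 4 * log rho + step 3 + step 4 + step 5 + step 6 + step 7 ∧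
    gain 3 6 = 5 * log rho + step 3 + step 4 + step 5 + step 6 + step 7 + step 8 ∧
    gain 4 5 = 4 * log rho + step 4 + step 5 + step 6 + step 7 + step 8 ∧
    gain 4 6 = 5 * log rho + step 4 + step 5 + step 6 + step 7 + step 8 + step 9 ∧
    gain 4 7 = 6 * log rho + step 4 + step 5 + step 6 + step 7 + step 8 + step 9 + step 10 ∧
    gain 5 6 = 5 * log rho + step 5 + step 6 + step 7 + step 8 + step 9 + step 10 ∧
    gain 5 7 = 6 * log rho + step 5 + step 6 + step 7 + step 8 + step 9 + step 10 + step 11 := by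
  refine ⟨?_, ?_, ?_, ?_, ?_, ?_, ?_, ?_, ?_, ?_, ?_, ?_⟩ <;>
    (simp only [gain, step]; norm_num; ring)

/-- A vertex with `x` tokens whose inequality follows from the linearisation, or which carries all
tokens. -/
def Linear (n x : ℕ) : Prop := ∀ r, 2 ≤ r → x ≤ r → Tame n x r ∨ (r = x ∧ Alone n x)

theorem linear_of_mul_step_le {n x : ℕ} (hn : 2 ≤ n) (h : x * step n ≤ gain n x) : Linear n x :=
  fun _ hr _ => Or.inl (tame_of_mul_step_le hn hr h)

/-- Only `r = x` needs the direct inequality; from `r = x + 1` on, `Tame` propagates by `tame_mono`.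
-/
theorem linear_of_alone {n x : ℕ} (hx : 2 ≤ x) (ha : Alone n x)
    (hK : x * step (x + 2) ≤ gain n x) (h : Tame n x (x + 1)) : Linear n x := by
  intro r _ hxr
  rcases hxr.eq_or_lt with rfl | hlt
  · exact Or.inr ⟨rfl, ha⟩
  · exact Or.inl (tame_mono (by omega) (by omega) (Nat.succ_le_of_lt hlt) hK h)

theorem alone_of_ratio {n x : ℕ} {q : ℝ} (hn : 2 ≤ n) (hx : 2 ≤ x) (hq : q * tangent n ≤ tangent x)
    (h : (x : ℝ) ^ 2 * b n / n ≤ q * b x * (rho ^ (x - 1) * b (n + x))) : Alone n x := by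
  unfold Alone
  rw [weight_eq n hn, weight_eq x hx]
  have ht := tangent_pos n hn
  have hx0 : (0 : ℝ) < x := by positivity
  have hb := b_pos x
  have hb2 := b_pos (n + x)
  have hr := rho_pos
  rw [div_mul_eq_mul_div, le_div_iff₀ hx0]
  calc (x : ℝ) * (tangent n * b n / n) * x = tangent n * ((x : ℝ) ^ 2 * b n / n) := by ring
    _ ≤ tangent n * (q * b x * (rho ^ (x - 1) * b (n + x))) := by gcongr
    _ = q * tangent n * (b x * (rho ^ (x - 1) * b (n + x))) := by ring
    _ ≤ tangent x * (b x * (rho ^ (x - 1) * b (n + x))) := by gcongr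
    _ = _ := by ring

theorem rho_pow_three_gt : 1.24075 < rho ^ 3 := by
  have := pow_lt_pow_left₀ rho_gt (by norm_num) (n := 3) (by norm_num)
  refine lt_trans (by norm_num) this

theorem rho_sq_gt : 1.15467 < rho ^ 2 := by
  have := pow_lt_pow_left₀ rho_gt (by norm_num) (n := 2) (by norm_num)
  refine lt_trans (by norm_num) this

theorem linear_two_three : Linear 2 3 := by
  have t3 := tangent_three
  have t4 := tangent_four
  have tp := tangent_pos 2 le_rfl
  obtain ⟨hg, -⟩ := gain_values
  have s2 := step_two_bounds
  have s3 := step_three_bounds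
  have s4 := step_four_bounds
  have hgt : 0.8844 < gain 2 3 := by rw [hg]; linarith [log_rho_gt]
  refine linear_of_alone (by norm_num) ?_ ?_ ?_
  · refine alone_of_ratio (q := 1.28423) (by norm_num) (by norm_num) t3 ?_
    norm_num
    rw [b_two]
    have h1 : (1.15467 : ℝ) * 2.2534 ≤ rho ^ 2 * b 5 := by
      have := rho_sq_gt; have := b_five_gt; gcongr
    have h2 : (1.4659 : ℝ) * (1.15467 * 2.2534) ≤ b 3 * (rho ^ 2 * b 5) := by
      have := b_three_gt; gcongr
    nlinarith [rho_lt]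
  · push_cast; linarith [step_five_bounds.2]
  · have hd : 0.0587 < defect 4 := by unfold defect; norm_num; linarith
    refine tame_of_ratio (q := 1.28423 * 1.14362) (by norm_num) (by linarith) ?_ ?_
    · push_cast; linarith
    · push_cast; linarith

theorem linear_two_four : Linear 2 4 := by
  have t3 := tangent_three
  have t4 := tangent_four
  have t5 := tangent_five
  have tp := tangent_pos 2 le_rfl
  obtain ⟨-, hg, -⟩ := gain_values
  have s2 := step_two_bounds
  have s3 := step_three_bounds
  have s4 := step_four_bounds
  have s5 := step_five_bounds
  have hgt : 1.1157 < gain 2 4 := by rw [hg]; linarith [log_rho_gt]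
  refine linear_of_alone (by norm_num) ?_ ?_ ?_
  · refine alone_of_ratio (q := 1.28423 * 1.14362) (by norm_num) (by norm_num) (by linarith) ?_
    norm_num
    rw [b_two]
    have h1 : (1.24075 : ℝ) * 2.6429 ≤ rho ^ 3 * b 6 := by
      have := rho_pow_three_gt; have := b_six_gt; gcongr
    have h2 : (1.8611 : ℝ) * (1.24075 * 2.6429) ≤ b 4 * (rho ^ 3 * b 6) := by
      have := b_four_gt; gcongr
    nlinarith [rho_lt]
  · push_cast; linarith [step_six_bounds.2]
  · have hd : 0.0406 < defect 5 := by unfold defect; norm_num; linarith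
    refine tame_of_ratio (q := 1.28423 * 1.14362 * 1.0906) (by norm_num) (by linarith) ?_ ?_
    · push_cast; linarith
    · push_cast; linarith

theorem linear_two_five : Linear 2 5 := by
  have t3 := tangent_three
  have t4 := tangent_four
  have t5 := tangent_five
  have t6 := tangent_six
  have tp := tangent_pos 2 le_rfl
  obtain ⟨-, -, hg, -⟩ := gain_values
  have s2 := step_two_bounds
  have s3 := step_three_bounds
  have s4 := step_four_bounds
  have s5 := step_five_bounds
  have s6 := step_six_bounds
  have hgt : 1.32426 < gain 2 5 := by rw [hg]; linarith [log_rho_gt]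
  refine linear_of_alone (by norm_num) ?_ ?_ ?_
  · refine alone_of_ratio (q := 1.28423 * 1.14362 * 1.0906) (by norm_num) (by norm_num)
      (by linarith) ?_
    norm_num [rho_pow]
    rw [b_two]
    have h2 : (2.2534 : ℝ) * (4 / 3 * 3.0298) ≤ b 5 * (4 / 3 * b 7) := by
      have := b_five_gt; have := b_seven_gt; gcongr
    nlinarith [rho_lt]
  · push_cast; linarith [step_seven_bounds.2]
  · have hd : 0.03001 < defect 6 := by unfold defect; norm_num; linarith
    refine tame_of_ratio (q := 1.28423 * 1.14362 * 1.0906 * 1.06353) (by norm_num) (by linarith)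
      ?_ ?_
    · push_cast; linarith
    · push_cast; linarith

theorem linear_three_four : Linear 3 4 := by
  have t4 := tangent_four
  have t5 := tangent_five
  have tp := tangent_pos 3 (by norm_num)
  obtain ⟨-, -, -, -, hg, -⟩ := gain_values
  have s3 := step_three_bounds
  have s4 := step_four_bounds
  have s5 := step_five_bounds
  have s6 := step_six_bounds
  have hgt : 0.9417 < gain 3 4 := by rw [hg]; linarith [log_rho_gt]
  refine linear_of_alone (by norm_num) ?_ ?_ ?_
  · refine alone_of_ratio (q := 1.14362) (by norm_num) (by norm_num) t4 ?_
    norm_num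
    have h1 : (1.24075 : ℝ) * 3.0298 ≤ rho ^ 3 * b 7 := by
      have := rho_pow_three_gt; have := b_seven_gt; gcongr
    have h2 : (1.8611 : ℝ) * (1.24075 * 3.0298) ≤ b 4 * (rho ^ 3 * b 7) := by
      have := b_four_gt; gcongr
    nlinarith [b_three_lt]
  · push_cast; linarith [step_six_bounds.2]
  · have hd : 0.0406 < defect 5 := by unfold defect; norm_num; linarith
    refine tame_of_ratio (q := 1.14362 * 1.0906) (by norm_num) (by linarith) ?_ ?_
    · push_cast; linarith
    · push_cast; linarith

theorem linear_three_five : Linear 3 5 := by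
  have t4 := tangent_four
  have t5 := tangent_five
  have t6 := tangent_six
  have tp := tangent_pos 3 (by norm_num)
  obtain ⟨-, -, -, -, -, hg, -⟩ := gain_values
  have s3 := step_three_bounds
  have s4 := step_four_bounds
  have s5 := step_five_bounds
  have s6 := step_six_bounds
  have s7 := step_seven_bounds
  have hgt : 1.1332 < gain 3 5 := by rw [hg]; linarith [log_rho_gt]
  refine linear_of_alone (by norm_num) ?_ ?_ ?_
  · refine alone_of_ratio (q := 1.14362 * 1.0906) (by norm_num) (by norm_num) (by linarith) ?_
    norm_num [rho_pow]
    have h2 : (2.2534 : ℝ) * (4 / 3 * 3.4147) ≤ b 5 * (4 / 3 * b 8) := by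
      have := b_five_gt; have := b_eight_gt; gcongr
    nlinarith [b_three_lt]
  · push_cast; linarith [step_seven_bounds.2]
  · have hd : 0.03 < defect 6 := by unfold defect; norm_num; linarith
    refine tame_of_ratio (q := 1.14362 * 1.0906 * 1.06353) (by norm_num) (by linarith) ?_ ?_
    · push_cast; linarith
    · push_cast; linarith

theorem linear_three_six : Linear 3 6 := by
  have t4 := tangent_four
  have t5 := tangent_five
  have t6 := tangent_six
  have t7 := tangent_seven
  have tp := tangent_pos 3 (by norm_num)
  obtain ⟨-, -, -, -, -, -, hg, -⟩ := gain_values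
  have s3 := step_three_bounds
  have s4 := step_four_bounds
  have s5 := step_five_bounds
  have s6 := step_six_bounds
  have s7 := step_seven_bounds
  have s8 := step_eight_bounds
  have hgt : 1.3115 < gain 3 6 := by rw [hg]; linarith [log_rho_gt]
  refine linear_of_alone (by norm_num) ?_ ?_ ?_
  · refine alone_of_ratio (q := 1.14362 * 1.0906 * 1.06353) (by norm_num) (by norm_num)
      (by linarith) ?_
    norm_num
    have e : rho ^ 5 = 4 / 3 * rho := by rw [← rho_pow]; ring
    rw [e]
    have h1 : (4 / 3 * 1.07456 : ℝ) * 3.7981 ≤ 4 / 3 * rho * b 9 := by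
      have := rho_gt; have := b_nine_gt; gcongr
    have h2 : (2.6429 : ℝ) * (4 / 3 * 1.07456 * 3.7981) ≤ b 6 * (4 / 3 * rho * b 9) := by
      have := b_six_gt; gcongr
    nlinarith [b_three_lt]
  · push_cast; linarith [step_eight_bounds.2]
  · have hd : 0.02322 < defect 7 := by unfold defect; norm_num; linarith
    refine tame_of_ratio (q := 1.14362 * 1.0906 * 1.06353 * 1.04751) (by norm_num) (by linarith)
      ?_ ?_
    · push_cast; linarith
    · push_cast; linarith

theorem linear_four_seven : Linear 4 7 := by
  have t5 := tangent_five
  have t6 := tangent_six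
  have t7 := tangent_seven
  have tp := tangent_pos 4 (by norm_num)
  obtain ⟨-, -, -, -, -, -, -, -, -, hg, -⟩ := gain_values
  have s4 := step_four_bounds
  have s5 := step_five_bounds
  have s6 := step_six_bounds
  have s7 := step_seven_bounds
  have s8 := step_eight_bounds
  have hgt : 1.327 < gain 4 7 := by
    rw [hg]; linarith [log_rho_gt, step_nine_gt, step_ten_gt]
  intro r _ hr
  -- Here `Tame` holds already at `r = x`, so `Alone` is not needed.
  refine Or.inl (tame_mono (r₀ := 7) (by norm_num) (by norm_num) hr ?_ ?_)
  · norm_num; linarith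
  · have hd : 0.02322 < defect 7 := by unfold defect; norm_num; linarith
    refine tame_of_ratio (q := 1.0906 * 1.06353 * 1.04751) (by norm_num) (by linarith) ?_ ?_
    · push_cast; linarith
    · push_cast; linarith

theorem tangent_two_gt : 2.71 < tangent 2 := by
  have h : tangent 2 = 2 * exp (step 2) := by
    have := b_succ 2
    have h2 := (b_pos 2).ne'
    simp only [tangent]
    rw [this]
    field_simp
  rw [h]
  have := quadratic_le_exp_of_nonneg (step_pos 2 (by norm_num)).le
  nlinarith [step_two_bounds.1]

theorem linear_one {x : ℕ} (hx : 2 ≤ x) (hx8 : x ≤ 8) : Linear 1 x := by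
  -- `0.227` is just below `gain 1 2 / 2`.
  have hg : (x : ℝ) * 0.227 ≤ gain 1 x := by
    have s1 := step_one
    have s2 := step_two_bounds.1
    have s3 := step_three_bounds.1
    have s4 := step_four_bounds.1
    have s5 := step_five_bounds.1
    have s6 := step_six_bounds.1
    have s7 := step_seven_bounds.1
    have s8 := step_eight_bounds.1
    have hl := log_rho_gt
    have g1 := gain_one 1
    have g2 := gain_succ 1 1
    have g3 := gain_succ 1 2
    have g4 := gain_succ 1 3
    have g5 := gain_succ 1 4
    have g6 := gain_succ 1 5
    have g7 := gain_succ 1 6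
    have g8 := gain_succ 1 7
    norm_num at g2 g3 g4 g5 g6 g7 g8
    interval_cases x <;> push_cast <;> linarith
  have t2 := tangent_two_gt
  have t3 := tangent_three
  intro r hr hxr
  left
  have hx0 : (0 : ℝ) < x := by positivity
  have ht := tangent_pos r hr
  have key : 1 ≤ tangent r * (defect r + 0.227) := by
    -- `r = 2` is separate because `step 4 < 0.227 < step 3`: the monotonicity in `r` is available
    -- only from `3` on.
    rcases hr.eq_or_lt with rfl | hlt
    · have hd : 0.189 < defect 2 := by unfold defect; norm_num; linarith [step_two_bounds.2]
      nlinarith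
    · refine le_trans ?_ (tangent_mul_mono (r₀ := 3) (by norm_num) hlt
        (by norm_num; linarith [step_four_bounds.2]))
      have hd : 0.094 < defect 3 := by unfold defect; norm_num; linarith [step_three_bounds.2]
      nlinarith
  unfold Tame
  calc (x : ℝ) * (weight 1 / b 1) = x * 1 := by simp [weight, b]
    _ ≤ x * (tangent r * (defect r + 0.227)) := by gcongr
    _ = tangent r * (x * defect r + x * 0.227) := by ring
    _ ≤ _ := by gcongr

theorem rho_pow_five : rho ^ 5 = 4 / 3 * rho := by rw [← rho_pow]; ring

theorem removable_two_six : Removable 2 6 := by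
  have t3 := tangent_three
  have t4 := tangent_four
  have t5 := tangent_five
  have tp := tangent_pos 2 le_rfl
  unfold Removable
  rw [weight_eq 2 le_rfl, weight_eq 5 (by norm_num)]
  norm_num [rho_pow, b_two]
  have h1 : 0.6388 ≤ rho * b 8 - b 7 := by nlinarith [rho_gt, b_eight_gt, b_seven_lt]
  -- `1.6017` is `1.28423 * 1.14362 * 1.0906` rounded down, a lower bound for `tangent 5 / tangent
  -- 2`.
  have h2 : 1.6017 * tangent 2 * 2.2534 ≤ tangent 5 * b 5 := by
    have := b_five_gt
    have := tangent_pos 5 (by norm_num)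
    gcongr
    linarith
  have h3 : 1.6017 * tangent 2 * 2.2534 / 5 * (4 / 3 * 0.6388) ≤
      tangent 5 * b 5 / 5 * (4 / 3 * (rho * b 8 - b 7)) := by
    have := b_pos 5
    have := tangent_pos 5 (by norm_num)
    gcongr
  nlinarith [rho_lt]

theorem rho_pow_five_mul_gt : 0.954 ≤ rho ^ 5 * (rho * b 9 - b 8) := by
  have h1 : 0.666 ≤ rho * b 9 - b 8 := by nlinarith [rho_gt, b_nine_gt, b_eight_lt]
  rw [rho_pow_five]
  nlinarith [rho_gt]

theorem removable_two_seven : Removable 2 7 := by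
  have t3 := tangent_three
  have t4 := tangent_four
  have t5 := tangent_five
  have tp := tangent_pos 2 le_rfl
  have hw := weight_le_succ 5
  unfold Removable
  rw [weight_eq 5 (by norm_num)] at hw
  rw [weight_eq 2 le_rfl]
  norm_num [b_two] at hw ⊢
  have h1 := rho_pow_five_mul_gt
  have h2 : 1.6017 * tangent 2 * 2.2534 ≤ tangent 5 * b 5 := by
    have := b_five_gt
    have := tangent_pos 5 (by norm_num)
    gcongr
    linarith
  have h3 : 1.6017 * tangent 2 * 2.2534 / 5 * 0.954 ≤
      weight 6 * (rho ^ 5 * (rho * b 9 - b 8)) := by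
    have := weight_pos 6
    gcongr
    linarith
  nlinarith [rho_lt]

theorem removable_three_seven : Removable 3 7 := by
  have t4 := tangent_four
  have t5 := tangent_five
  have tp := tangent_pos 3 (by norm_num)
  have hw := weight_le_succ 5
  unfold Removable
  rw [weight_eq 5 (by norm_num)] at hw
  rw [weight_eq 3 (by norm_num)]
  norm_num at hw ⊢
  have h1 : 0.99 ≤ rho ^ 5 * (rho * b 10 - b 9) := by
    have h1 : 0.693 ≤ rho * b 10 - b 9 := by nlinarith [rho_gt, b_ten_gt, b_nine_lt]
    rw [rho_pow_five]
    nlinarith [rho_gt]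
  have h2 : 1.2472 * tangent 3 * 2.2534 ≤ tangent 5 * b 5 := by
    have := b_five_gt
    have := tangent_pos 5 (by norm_num)
    gcongr
    linarith
  have h3 : 1.2472 * tangent 3 * 2.2534 / 5 * 0.99 ≤
      weight 6 * (rho ^ 5 * (rho * b 10 - b 9)) := by
    have := weight_pos 6
    gcongr
    linarith
  nlinarith [b_three_lt]

theorem linear_of_le_six {n x : ℕ} (hn : 2 ≤ n) (hn6 : n ≤ 6) (hx : 1 ≤ x) (hx7 : x ≤ 7) :
    Linear n x ∨ (3 ≤ x ∧ Removable n x) := by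
  obtain ⟨-, -, -, g33, -, -, -, g45, g46, -, g56, g57⟩ := gain_values
  have s2 := step_two_bounds
  have s3 := step_three_bounds
  have s4 := step_four_bounds
  have s5 := step_five_bounds
  have s6 := step_six_bounds
  have s7 := step_seven_bounds
  have s8 := step_eight_bounds
  have s9 := step_nine_gt
  have s10 := step_ten_gt
  have s11 := step_eleven_gt
  have s12 := step_sub_le (n := 10) (k := 12) (by norm_num) (by norm_num)
  -- This is in fact an equality, and it is what fixes the value of `ρ`: two tokens at a vertex with
  -- two free edges.
  have s23 : step 2 - step 3 ≤ log rho := by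
    have h := step_rec 2 (by norm_num)
    rw [log_three_halves] at h
    norm_num at h
    have h2 := step_two
    have h3 := log_rho
    linarith
  norm_num at s12
  have hl := log_rho_gt
  have auto : step n - step (n + x - 1) ≤ log rho → Linear n x := fun h =>
    linear_of_mul_step_le hn (mul_step_le_gain hn hx h)
  have direct : x * step n ≤ gain n x → Linear n x := linear_of_mul_step_le hn
  interval_cases n <;> interval_cases x <;> norm_num at auto direct
  all_goals first
    | exact Or.inl (auto (by linarith))
    | exact Or.inl (direct (by linarith))
    | exact Or.inl auto
    | exact Or.inl linear_two_three
    | exact Or.inl linear_two_four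
    | exact Or.inl linear_two_five
    | exact Or.inr ⟨by norm_num, removable_two_six⟩
    | exact Or.inr ⟨by norm_num, removable_two_seven⟩
    | exact Or.inl linear_three_four
    | exact Or.inl linear_three_five
    | exact Or.inl linear_three_six
    | exact Or.inr ⟨by norm_num, removable_three_seven⟩
    | exact Or.inl linear_four_seven

/-- Every vertex is of one of the two kinds. -/
theorem linear_or_removable {n x : ℕ} (hn : 1 ≤ n) (hx : 1 ≤ x) (hnx : 3 ≤ n + x) :
    Linear n x ∨ (3 ≤ x ∧ Removable n x) := by
  have hl := log_rho_gt
  rcases hn.eq_or_lt with rfl | hn2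
  · rcases Nat.lt_or_ge 8 x with h | h
    · exact Or.inr ⟨by omega, removable_of_le (by omega) (by omega) (by omega)⟩
    · exact Or.inl (linear_one (by omega) h)
  have hn2 : 2 ≤ n := hn2
  rcases Nat.lt_or_ge 7 x with h | h
  · rcases Nat.lt_or_ge n x with h' | h'
    · exact Or.inr ⟨by omega, removable_of_le (by omega) (by omega) (by omega)⟩
    · left
      refine linear_of_mul_step_le hn2 (mul_step_le_gain hn2 hx ?_)
      have h1 := step_sub_le (n := n) (k := n + x - 1) hn2 (by omega)
      have hn8 : (8 : ℝ) ≤ n := by exact_mod_cast (by omega : 8 ≤ n)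
      have h2 : ((n + x - 1 : ℕ) : ℝ) ≤ 2 * n := by exact_mod_cast (by omega : n + x - 1 ≤ 2 * n)
      have h3 : (0 : ℝ) < ((n + x - 1 : ℕ) : ℝ) := by exact_mod_cast (by omega : 0 < n + x - 1)
      have h4 : 1 / (2 * (n : ℝ)) ≤ 1 / ((n + x - 1 : ℕ) : ℝ) := by gcongr
      have h5 : 1 / (n : ℝ) = 2 * (1 / (2 * (n : ℝ))) := by field_simp
      -- `1/16` is below `log rho ≈ 0.0719`; in the case `n ≥ 7`, `x ≤ 7` below, `6/91` is too.
      have h6 : 1 / (2 * (n : ℝ)) ≤ 1 / (2 * 8) := by gcongr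
      linarith
  · rcases Nat.lt_or_ge 6 n with h' | h'
    · left
      refine linear_of_mul_step_le hn2 (mul_step_le_gain hn2 hx ?_)
      have h0 := step_le_step (n := n + x - 1) (k := n + 6) (by omega) (by omega)
      have h1 := step_sub_le (n := n) (k := n + 6) hn2 (by omega)
      have hn7 : (7 : ℝ) ≤ n := by exact_mod_cast h'
      push_cast at h1
      have h2 : 1 / (n : ℝ) - 1 / (n + 6) = 6 / (n * (n + 6)) := by field_simp; ring
      have h3 : 6 / ((n : ℝ) * (n + 6)) ≤ 6 / (7 * (7 + 6)) := by gcongr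
      norm_num at h3
      linarith
    · exact linear_of_le_six hn2 h' hx h

/-! ### The token inequality -/

/-- The factor by which `x` tokens at a vertex with `n` further edges raise the potential, all
tokens but one being long. -/
noncomputable def factor (n x : ℕ) : ℝ := rho ^ (x - 1) * b (n + x) / b n

theorem one_le_factor (n x : ℕ) : 1 ≤ factor n x := by
  unfold factor
  rw [mul_div_assoc]
  have h1 : 1 ≤ rho ^ (x - 1) := one_le_pow₀ rho_gt_one.le
  have h2 : 1 ≤ b (n + x) / b n := by
    rw [one_le_div (b_pos n)]; exact b_mono (by omega)
  nlinarith

theorem factor_eq_mul (n x : ℕ) (hx : 2 ≤ x) :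
    factor n x = factor n (x - 1) * (rho * b (n + x) / b (n + x - 1)) := by
  obtain ⟨y, rfl⟩ := Nat.exists_eq_add_of_le' hx
  have h1 := (b_pos n).ne'
  have h2 := (b_pos (n + (y + 1))).ne'
  have e1 : n + (y + 2) - 1 = n + (y + 1) := by omega
  have e2 : y + 2 - 1 = y + 1 := by omega
  have e3 : y + 1 - 1 = y := by omega
  unfold factor
  rw [e1, e2, e3]
  field_simp
  ring

/-- The right side is `tangent r * exp (G - r * step r)`, with `G` the total gain. By `exp u ≥ 1 +
u` and `r * defect r = 1 - r * step r` it is at least the sum over vertices of the right sides of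
`Tame`. -/
theorem sum_cost_le_of_tame {ι : Type*} (T : Finset ι) (n x : ι → ℕ) (hx : ∀ i ∈ T, 1 ≤ x i)
    (hr : 2 ≤ ∑ i ∈ T, x i) (h : ∀ i ∈ T, Tame (n i) (x i) (∑ i ∈ T, x i)) :
    ∑ i ∈ T, (x i : ℝ) * (weight (n i) / b (n i)) ≤
      weight (∑ i ∈ T, x i) * ∏ i ∈ T, factor (n i) (x i) := by
  set r := ∑ i ∈ T, x i with hrdef
  have ht := tangent_pos r hr
  have hr0 : (0 : ℝ) < r := by positivity
  have e1 : ∏ i ∈ T, factor (n i) (x i) = exp (∑ i ∈ T, gain (n i) (x i)) := by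
    rw [exp_sum]
    exact prod_congr rfl fun i hi => (exp_gain _ _ (hx i hi)).symm
  have e2 : (∑ i ∈ T, (x i : ℝ)) = r := by rw [hrdef]; push_cast; rfl
  have e3 : (r : ℝ) * defect r = 1 - r * step r := by unfold defect; field_simp
  calc ∑ i ∈ T, (x i : ℝ) * (weight (n i) / b (n i))
      ≤ ∑ i ∈ T, tangent r * (x i * defect r + gain (n i) (x i)) := sum_le_sum h
    _ = tangent r * ((∑ i ∈ T, gain (n i) (x i)) - r * step r + 1) := by
      rw [← mul_sum, sum_add_distrib, ← sum_mul, e2, e3]; ring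
    _ ≤ tangent r * exp ((∑ i ∈ T, gain (n i) (x i)) - r * step r) := by
      gcongr; exact add_one_le_exp _
    _ = weight r * exp (∑ i ∈ T, gain (n i) (x i)) := by
      rw [← weight_mul_exp r hr, exp_sub]
      have := exp_pos (r * step r)
      field_simp
    _ = _ := by rw [e1]

/-- Induction on the number of tokens. A removable vertex gives up one token, whose cost is covered
by the increase of its own factor. Without such vertices, either all are `Tame` or one vertex
carries all tokens. -/
theorem sum_cost_le {ι : Type*} [DecidableEq ι] (T : Finset ι) (n x : ι → ℕ)
    (hn : ∀ i ∈ T, 1 ≤ n i) (hx : ∀ i ∈ T, 1 ≤ x i) (hnx : ∀ i ∈ T, 3 ≤ n i + x i) :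
    ∑ i ∈ T, (x i : ℝ) * (weight (n i) / b (n i)) ≤
      weight (∑ i ∈ T, x i) * ∏ i ∈ T, factor (n i) (x i) := by
  induction hr : ∑ i ∈ T, x i using Nat.strong_induction_on generalizing x with
  | _ r ih =>
  subst hr
  have alone : ∀ i ∈ T, ∑ j ∈ T, x j = x i → T = {i} := by
    intro i hi h
    refine eq_singleton_iff_unique_mem.2 ⟨hi, fun j hj => ?_⟩
    by_contra hne
    have h1 := add_sum_erase T x hi
    have h2 : x j ≤ ∑ k ∈ T.erase i, x k :=
      single_le_sum (fun _ _ => Nat.zero_le _) (mem_erase.2 ⟨hne, hj⟩)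
    have := hx j hj
    omega
  by_cases hrem : ∃ i ∈ T, 3 ≤ x i ∧ Removable (n i) (x i)
  · obtain ⟨i, hi, h3, hR⟩ := hrem
    set y := Function.update x i (x i - 1) with hy
    have hyi : y i = x i - 1 := by simp [hy]
    have hyj : ∀ j ∈ T.erase i, y j = x j := fun j hj => by
      simp [hy, Function.update_of_ne (ne_of_mem_erase hj)]
    have hsum : ∑ j ∈ T, x j = ∑ j ∈ T, y j + 1 := by
      have h1 := add_sum_erase T x hi
      have h2 := add_sum_erase T y hi
      have h4 : ∑ j ∈ T.erase i, y j = ∑ j ∈ T.erase i, x j := sum_congr rfl hyj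
      omega
    have hprop : ∀ j ∈ T, 1 ≤ y j ∧ 3 ≤ n j + y j := by
      intro j hj
      by_cases hji : j = i
      · subst hji
        rw [hyi]
        have := hn j hj
        omega
      · rw [hyj j (mem_erase.2 ⟨hji, hj⟩)]
        exact ⟨hx j hj, hnx j hj⟩
    have IH := ih (∑ j ∈ T, y j) (by omega) y (fun j hj => (hprop j hj).1)
      (fun j hj => (hprop j hj).2) rfl
    have hbn := b_pos (n i)
    have hbx := b_pos (n i + x i - 1)
    set Z := ∏ j ∈ T.erase i, factor (n j) (x j) with hZ
    have hZ1 : 1 ≤ Z := by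
      rw [hZ]
      exact Finset.one_le_prod fun j _ => one_le_factor _ _
    have hprody : ∏ j ∈ T, factor (n j) (y j) = factor (n i) (x i - 1) * Z := by
      rw [← mul_prod_erase T _ hi, hyi]
      congr 1
      exact prod_congr rfl fun j hj => by rw [hyj j hj]
    have hprodx : ∏ j ∈ T, factor (n j) (x j) =
        factor (n i) (x i - 1) * (rho * b (n i + x i) / b (n i + x i - 1)) * Z := by
      rw [← mul_prod_erase T _ hi, factor_eq_mul _ _ (by omega)]
    have hcost : ∑ j ∈ T, (x j : ℝ) * (weight (n j) / b (n j)) =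
        ∑ j ∈ T, (y j : ℝ) * (weight (n j) / b (n j)) + weight (n i) / b (n i) := by
      rw [← add_sum_erase T _ hi, ← add_sum_erase T (fun j => (y j : ℝ) * _) hi, hyi,
        sum_congr rfl (fun j hj => by rw [hyj j hj] :
          ∀ j ∈ T.erase i, (y j : ℝ) * (weight (n j) / b (n j)) = x j * (weight (n j) / b (n j)))]
      push_cast [Nat.cast_sub (by omega : 1 ≤ x i)]
      ring
    rw [hcost, hprodx]
    rw [hprody] at IH
    set q := rho * b (n i + x i) / b (n i + x i - 1) with hq
    have hF := one_le_factor (n i) (x i - 1)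
    have hle : x i - 1 ≤ ∑ j ∈ T, y j := by
      rw [← hyi]; exact single_le_sum (fun _ _ => Nat.zero_le _) hi
    have hq1 : 1 ≤ q := by
      rw [hq, one_le_div hbx]
      have : b (n i + x i - 1) ≤ b (n i + x i) := b_mono (by omega)
      nlinarith [rho_gt_one, b_pos (n i + x i)]
    have hRem : weight (n i) / b (n i) ≤
        weight (x i - 1) * (factor (n i) (x i - 1) * (q - 1)) := by
      have e : weight (x i - 1) * (factor (n i) (x i - 1) * (q - 1)) =
          weight (x i - 1) * (rho ^ (x i - 2) * (rho * b (n i + x i) - b (n i + x i - 1)))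
            / b (n i) := by
        rw [hq, factor, show n i + (x i - 1) = n i + x i - 1 by omega,
          show x i - 1 - 1 = x i - 2 by omega]
        field_simp
      rw [e]
      gcongr
      exact hR
    have hw1 := weight_mono hle
    have hw2 : weight (∑ j ∈ T, y j) ≤ weight (∑ j ∈ T, x j) := weight_mono (by omega)
    have hwp := weight_pos (∑ j ∈ T, y j)
    calc ∑ j ∈ T, (y j : ℝ) * (weight (n j) / b (n j)) + weight (n i) / b (n i)
        ≤ weight (∑ j ∈ T, y j) * (factor (n i) (x i - 1) * Z) +
          weight (∑ j ∈ T, y j) * (factor (n i) (x i - 1) * (q - 1)) := by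
          refine add_le_add IH (hRem.trans ?_)
          refine mul_le_mul_of_nonneg_right hw1 (mul_nonneg (by linarith) (by linarith))
      _ ≤ weight (∑ j ∈ T, y j) * (factor (n i) (x i - 1) * Z) +
          weight (∑ j ∈ T, y j) * (factor (n i) (x i - 1) * (q - 1) * Z) := by
          have h : factor (n i) (x i - 1) * (q - 1) ≤ factor (n i) (x i - 1) * (q - 1) * Z :=
            le_mul_of_one_le_right (mul_nonneg (by linarith) (by linarith)) hZ1
          linarith [mul_le_mul_of_nonneg_left h hwp.le]
      _ = weight (∑ j ∈ T, y j) * (factor (n i) (x i - 1) * q * Z) := by ring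
      _ ≤ weight (∑ j ∈ T, x j) * (factor (n i) (x i - 1) * q * Z) := by
          gcongr
  · have hlin : ∀ i ∈ T, Linear (n i) (x i) := fun i hi =>
      (linear_or_removable (hn i hi) (hx i hi) (hnx i hi)).resolve_right
        fun h => hrem ⟨i, hi, h⟩
    have single : ∀ i ∈ T, x i * weight (n i) ≤
          weight (x i) * (rho ^ (x i - 1) * b (n i + x i)) → T = {i} →
        ∑ i ∈ T, (x i : ℝ) * (weight (n i) / b (n i)) ≤
          weight (∑ i ∈ T, x i) * ∏ i ∈ T, factor (n i) (x i) := by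
      intro i _ h hT
      have hb := b_pos (n i)
      rw [hT, sum_singleton, sum_singleton, prod_singleton, factor, mul_div_assoc',
        mul_div_assoc']
      gcongr
    rcases T.eq_empty_or_nonempty with rfl | ⟨i, hi⟩
    · simp [(weight_pos 0).le]
    rcases Nat.lt_or_ge (∑ i ∈ T, x i) 2 with hr | hr
    · have h1 : x i ≤ ∑ i ∈ T, x i := single_le_sum (fun _ _ => Nat.zero_le _) hi
      have h2 := hx i hi
      have h3 : x i = 1 := by omega
      refine single i hi ?_ (alone i hi (by omega))
      rw [h3]
      have := weight_le_b_succ (n i) (hn i hi)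
      simpa [weight] using this
    by_cases hall : ∀ i ∈ T, Tame (n i) (x i) (∑ i ∈ T, x i)
    · exact sum_cost_le_of_tame T n x hx hr hall
    · push Not at hall
      obtain ⟨j, hj, hjt⟩ := hall
      have h1 : x j ≤ ∑ i ∈ T, x i := single_le_sum (fun _ _ => Nat.zero_le _) hj
      obtain h | ⟨h2, h3⟩ := hlin j hj _ hr h1
      · exact absurd h hjt
      · exact single j hj h3 (alone j hj h2)

/-! ### Counting paths -/

section Paths

variable {V : Type*} [DecidableEq V] (G : SimpleGraph V) [DecidableRel G.Adj] (t : V)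

/-- The vertex sequences of the paths from `w` to `t` with all vertices in `S`. -/
def pathLists (S : Finset V) (w : V) : Finset (List V) :=
  if _h : w ∈ S then
    if w = t then {[t]}
    else ((S.erase w).filter (G.Adj w)).biUnion fun y => (pathLists (S.erase w) y).image (w :: ·)
  else ∅
termination_by S.card
decreasing_by exact card_erase_lt_of_mem _h

/-- The number of neighbours of `v` in `S`. -/
def degIn (S : Finset V) (v : V) : ℕ := (S.filter (G.Adj v)).card

variable {G t} {S : Finset V} {v w : V}

theorem pathLists_of_notMem (h : w ∉ S) : pathLists G t S w = ∅ := by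
  rw [pathLists, dif_neg h]

theorem pathLists_self (h : t ∈ S) : pathLists G t S t = {[t]} := by
  rw [pathLists, dif_pos h, if_pos rfl]

theorem pathLists_of_ne (h : w ∈ S) (hw : w ≠ t) :
    pathLists G t S w =
      ((S.erase w).filter (G.Adj w)).biUnion fun y =>
        (pathLists G t (S.erase w) y).image (w :: ·) := by
  rw [pathLists, dif_pos h, if_neg hw]

theorem card_pathLists_self_le : (pathLists G t S t).card ≤ 1 := by
  by_cases h : t ∈ S
  · simp [pathLists_self h]
  · simp [pathLists_of_notMem h]

theorem card_pathLists_le (hw : w ≠ t) :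
    (pathLists G t S w).card ≤
      ∑ y ∈ (S.erase w).filter (G.Adj w), (pathLists G t (S.erase w) y).card := by
  by_cases h : w ∈ S
  · rw [pathLists_of_ne h hw]
    exact card_biUnion_le.trans (sum_le_sum fun y _ => card_image_le)
  · simp [pathLists_of_notMem h]

theorem filter_erase_adj : (S.erase w).filter (G.Adj w) = S.filter (G.Adj w) := by
  rw [filter_erase, erase_eq_of_notMem (by simp)]

theorem degIn_erase_add (S : Finset V) (hv : v ∈ S) :
    degIn G (S.erase v) w + (if G.Adj v w then 1 else 0) = degIn G S w := by
  unfold degIn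
  rw [filter_erase]
  split_ifs with h
  · exact card_erase_add_one (by simp [hv, h.symm])
  · rw [erase_eq_of_notMem (by
      rw [mem_filter, not_and]; exact fun _ h' => h h'.symm), add_zero]

theorem degIn_erase_le : degIn G (S.erase v) w ≤ degIn G S w :=
  card_le_card (filter_subset_filter _ (erase_subset _ _))

theorem pathLists_eq_empty_of_degIn (hw : w ≠ t) (h : degIn G S w = 0) :
    pathLists G t S w = ∅ := by
  have := card_pathLists_le (G := G) (S := S) hw
  rw [filter_erase_adj, card_eq_zero.1 h] at this
  simpa using this

/-- A vertex with at most one neighbour lies on no path between other vertices. -/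
theorem pathLists_subset_erase (hv : v ≠ t) (hwv : w ≠ v) (h : degIn G S v ≤ 1) :
    pathLists G t S w ⊆ pathLists G t (S.erase v) w := by
  induction hn : S.card using Nat.strong_induction_on generalizing S w with
  | _ n ih =>
  subst hn
  by_cases hw : w ∈ S
  swap
  · simp [pathLists_of_notMem hw]
  have hw' : w ∈ S.erase v := mem_erase.2 ⟨hwv, hw⟩
  by_cases hwt : w = t
  · subst hwt
    rw [pathLists_self hw, pathLists_self hw']
  rw [pathLists_of_ne hw hwt, pathLists_of_ne hw' hwt, erase_right_comm]
  refine biUnion_subset.2 fun y hy => ?_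
  rw [mem_filter, mem_erase] at hy
  by_cases hyv : y = v
  · subst hyv
    have hd := degIn_erase_add (G := G) (v := w) (w := y) S hw
    rw [if_pos hy.2] at hd
    rw [pathLists_eq_empty_of_degIn hv (by omega)]
    simp
  · refine subset_trans ?_ (subset_biUnion_of_mem _ (x := y) ?_)
    · exact image_subset_image
        (ih _ (card_erase_lt_of_mem hw) hyv (degIn_erase_le.trans h) rfl)
    · simp [hyv, hy]

theorem pathLists_eq_empty_of_degIn_end (hwt : w ≠ t) (h : degIn G S t = 0) :
    pathLists G t S w = ∅ := by
  induction hn : S.card using Nat.strong_induction_on generalizing S w with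
  | _ n ih =>
  subst hn
  by_cases hw : w ∈ S
  swap
  · simp [pathLists_of_notMem hw]
  rw [pathLists_of_ne hw hwt]
  refine subset_empty.1 (biUnion_subset.2 fun y hy => ?_)
  rw [mem_filter, mem_erase] at hy
  by_cases hyt : y = t
  · subst hyt
    have hd := degIn_erase_add (G := G) (v := w) (w := y) S hw
    rw [if_pos hy.2] at hd
    omega
  · have := degIn_erase_le (G := G) (S := S) (v := w) (w := t)
    rw [ih _ (card_erase_lt_of_mem hw) hyt (by omega) rfl, image_empty]

/-! ### Tokens and the potential. -/

/-- `1` at the end vertex `t` and `0` elsewhere. -/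
def endMark (t v : V) : ℕ := if v = t then 1 else 0

variable (G t) in
/-- The number of paths to `t` from tokens placed on the vertices in `S`. -/
def tokenSum (S : Finset V) (x : V → ℕ) : ℝ :=
  ∑ w ∈ S, (x w : ℝ) * (pathLists G t S w).card

variable (G t) in
/-- The potential bounding `tokenSum`, with `ε` short and `μ` long tokens at each vertex. -/
noncomputable def potential (S : Finset V) (ε μ : V → ℕ) : ℝ :=
  weight (∑ w ∈ S, (ε w + μ w)) *
    (rho ^ (∑ w ∈ S, μ w) * ∏ v ∈ S, b (degIn G S v + endMark t v + (ε v + μ v)))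

theorem one_le_potential (S : Finset V) (ε μ : V → ℕ) : 1 ≤ potential G t S ε μ := by
  have h1 := one_le_weight (∑ w ∈ S, (ε w + μ w))
  have h2 : 1 ≤ rho ^ (∑ w ∈ S, μ w) := one_le_pow₀ rho_gt_one.le
  have h3 : 1 ≤ ∏ v ∈ S, b (degIn G S v + endMark t v + (ε v + μ v)) :=
    Finset.one_le_prod fun v _ => one_le_b _
  exact one_le_mul_of_one_le_of_one_le h1 (one_le_mul_of_one_le_of_one_le h2 h3)

/-- Moving the only token of a vertex with one further neighbour to that neighbour. -/
theorem exists_slide (ε μ : V → ℕ) (hv : v ∈ S) (hvt : v ≠ t) (hx : ε v + μ v = 1)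
    (hd : degIn G S v = 1) :
    ∃ μ' : V → ℕ, tokenSum G t S (fun w => ε w + μ w) ≤
        tokenSum G t (S.erase v) (fun w => ε w + μ' w) ∧
      potential G t (S.erase v) ε μ' ≤ potential G t S ε μ := by
  obtain ⟨z, hz⟩ := card_eq_one.1 hd
  have hadj : ∀ w ∈ S, G.Adj v w ↔ w = z := fun w hw => by
    have : w ∈ S.filter (G.Adj v) ↔ w ∈ ({z} : Finset V) := by rw [hz]
    simpa [hw] using this
  have hzS : z ∈ S ∧ G.Adj v z := by
    have : z ∈ S.filter (G.Adj v) := by rw [hz]; simp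
    simpa using this
  have hzv : z ≠ v := hzS.2.ne'
  have hz' : z ∈ S.erase v := mem_erase.2 ⟨hzv, hzS.1⟩
  set μ' : V → ℕ := fun w => μ w + if w = z then 1 else 0 with hμ'
  have hsum : ∀ f : V → ℕ, ∑ w ∈ S.erase v, (f w + if w = z then 1 else 0) =
      ∑ w ∈ S.erase v, f w + 1 := fun f => by
    rw [sum_add_distrib, sum_ite_eq', if_pos hz']
  refine ⟨μ', ?_, ?_⟩
  · unfold tokenSum
    rw [← add_sum_erase S _ hv]
    dsimp only
    rw [hx]
    have e1 : ((pathLists G t S v).card : ℝ) ≤ (pathLists G t (S.erase v) z).card := by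
      have := card_pathLists_le (G := G) (S := S) hvt
      rw [filter_erase_adj, hz, sum_singleton] at this
      exact_mod_cast this
    have e2 : ∀ w ∈ S.erase v, ((ε w + μ' w : ℕ) : ℝ) * (pathLists G t (S.erase v) w).card =
        ((ε w + μ w : ℕ) : ℝ) * (pathLists G t (S.erase v) w).card +
          if w = z then ((pathLists G t (S.erase v) z).card : ℝ) else 0 := fun w _ => by
      simp only [hμ']
      split_ifs with h
      · subst h; push_cast; ring
      · simp
    rw [sum_congr rfl e2, sum_add_distrib, sum_ite_eq', if_pos hz', add_comm]
    push_cast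
    rw [one_mul]
    refine add_le_add (sum_le_sum fun w hw => ?_) e1
    have : (pathLists G t S w).card ≤ (pathLists G t (S.erase v) w).card :=
      card_le_card (pathLists_subset_erase hvt (ne_of_mem_erase hw) hd.le)
    gcongr
  · unfold potential
    have e1 : ∑ w ∈ S.erase v, (ε w + μ' w) = ∑ w ∈ S, (ε w + μ w) := by
      rw [← add_sum_erase S _ hv, hx, add_comm, ← hsum]
      exact sum_congr rfl fun w _ => by rw [hμ', add_assoc]
    have e2 : ∑ w ∈ S.erase v, μ' w = ∑ w ∈ S.erase v, μ w + 1 := hsum μ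
    -- Erasing `v` costs `z` an edge, which the arriving token replaces.
    have e3 : ∏ w ∈ S.erase v, b (degIn G (S.erase v) w + endMark t w + (ε w + μ' w)) =
        ∏ w ∈ S.erase v, b (degIn G S w + endMark t w + (ε w + μ w)) := by
      refine prod_congr rfl fun w hw => ?_
      have := degIn_erase_add (G := G) (v := v) (w := w) S hv
      have h2 := hadj w (mem_of_mem_erase hw)
      have e : (if w = z then 1 else 0) = if G.Adj v w then 1 else 0 := by simp [h2]
      rw [hμ', ← this]
      simp only [e]
      congr 1
      ring
    -- The lost factor `b 2 = ρ` pays for the new long token.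
    have e4 : b (degIn G S v + endMark t v + (ε v + μ v)) = rho := by
      rw [hd, hx, endMark, if_neg hvt, b_two]
    rw [e1, e2, e3, ← add_sum_erase S μ hv, ← mul_prod_erase S _ hv, e4]
    refine mul_le_mul_of_nonneg_left ?_ (weight_pos _).le
    rw [pow_succ, pow_add, mul_assoc, mul_assoc]
    refine le_mul_of_one_le_left ?_ (one_le_pow₀ rho_gt_one.le)
    have := rho_pos
    have h5 : 0 ≤ ∏ w ∈ S.erase v, b (degIn G S w + endMark t w + (ε w + μ w)) :=
      prod_nonneg fun w _ => (b_pos _).le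
    positivity

/-- The induction step at a path end. -/
theorem card_pathLists_le_weight (hw : w ∈ S) (hwt : w ≠ t)
    (ih : ∀ ε : V → ℕ, (∀ v, ε v ≤ 1) →
      tokenSum G t (S.erase w) (fun v => ε v + 0) ≤ potential G t (S.erase w) ε (fun _ => 0)) :
    ((pathLists G t S w).card : ℝ) ≤
      weight (degIn G S w) * ∏ v ∈ S.erase w, b (degIn G S v + endMark t v) := by
  -- One short token on each neighbour of `w`, in place of the edge to `w`.
  have h := ih (fun v => if G.Adj w v then 1 else 0) (fun v => by split_ifs <;> simp)
  unfold tokenSum potential at h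
  have e1 : ∑ v ∈ S.erase w, ((if G.Adj w v then 1 else 0) + 0) = degIn G S w := by
    simp only [add_zero, sum_boole, Nat.cast_id, filter_erase_adj]
    rfl
  have e2 : ∀ v ∈ S.erase w, b (degIn G (S.erase w) v + endMark t v +
      ((if G.Adj w v then 1 else 0) + 0)) = b (degIn G S v + endMark t v) := fun v _ => by
    rw [← degIn_erase_add (G := G) (v := w) (w := v) S hw]
    congr 1
    ring
  rw [e1, prod_congr rfl e2, sum_const_zero, pow_zero, one_mul] at h
  refine le_trans ?_ h
  have h2 := card_pathLists_le (G := G) (S := S) hwt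
  rw [sum_filter] at h2
  calc ((pathLists G t S w).card : ℝ) ≤
      ((∑ y ∈ S.erase w, if G.Adj w y then (pathLists G t (S.erase w) y).card else 0 : ℕ) : ℝ) := by
        exact_mod_cast h2
    _ = _ := by
      push_cast
      refine sum_congr rfl fun y _ => ?_
      split_ifs <;> simp

theorem tokenSum_le_potential (S : Finset V) (ε μ : V → ℕ) (hε : ∀ v, ε v ≤ 1) :
    tokenSum G t S (fun w => ε w + μ w) ≤ potential G t S ε μ := by
  induction hS : S.card using Nat.strong_induction_on generalizing S ε μ with
  | _ n ih =>
  subst hS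
  by_cases hslide : ∃ v ∈ S, v ≠ t ∧ ε v + μ v = 1 ∧ degIn G S v = 1
  · obtain ⟨v, hv, hvt, hx, hd⟩ := hslide
    obtain ⟨μ', h1, h2⟩ := exists_slide ε μ hv hvt hx hd
    exact h1.trans ((ih _ (card_erase_lt_of_mem hv) _ ε μ' hε rfl).trans h2)
  -- A lone token on an isolated `t` is the other case with `n + x < 3`; then only the trivial path
  -- counts.
  by_cases hend : ε t + μ t = 1 ∧ degIn G S t = 0
  · refine le_trans ?_ (one_le_potential S ε μ)
    unfold tokenSum
    calc ∑ w ∈ S, ((ε w + μ w : ℕ) : ℝ) * (pathLists G t S w).card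
        ≤ ∑ w ∈ S, if w = t then (1 : ℝ) else 0 := by
          refine sum_le_sum fun w _ => ?_
          split_ifs with hw
          · subst hw
            rw [hend.1]
            have := card_pathLists_self_le (G := G) (t := w) (S := S)
            simpa using this
          · rw [pathLists_eq_empty_of_degIn_end hw hend.2]; simp
      _ ≤ 1 := by rw [sum_ite_eq']; split_ifs <;> norm_num
  set x : V → ℕ := fun w => ε w + μ w with hx
  set n : V → ℕ := fun w => degIn G S w + endMark t w with hn
  -- Token vertices with no free edge are dead ends and contribute nothing.
  set T := S.filter fun w => 1 ≤ x w ∧ 1 ≤ n w with hT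
  have hTS : T ⊆ S := filter_subset _ _
  have key := sum_cost_le T n x (fun i hi => (mem_filter.1 hi).2.2)
    (fun i hi => (mem_filter.1 hi).2.1) (fun i hi => by
      obtain ⟨hiS, h1, h2⟩ := mem_filter.1 hi
      by_contra hlt
      have hx1 : x i = 1 := by omega
      have hn1 : n i = 1 := by omega
      by_cases hit : i = t
      · subst hit
        have : degIn G S i + 1 = 1 := by simpa [hn, endMark] using hn1
        exact hend ⟨hx1, by omega⟩
      · exact hslide ⟨i, hiS, hit, hx1, by simpa [hn, endMark, hit] using hn1⟩)
  set B := ∏ v ∈ S, b (n v) with hB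
  have hBpos : 0 < B := prod_pos fun v _ => b_pos _
  have hbound : ∀ w ∈ S, ((pathLists G t S w).card : ℝ) ≤ B * (weight (n w) / b (n w)) := by
    intro w hw
    have e : B * (weight (n w) / b (n w)) = weight (n w) * ∏ v ∈ S.erase w, b (n v) := by
      rw [hB, ← mul_prod_erase S _ hw]
      have := (b_pos (n w)).ne'
      field_simp
    rw [e]
    by_cases hwt : w = t
    · subst hwt
      have h1 : ((pathLists G w S w).card : ℝ) ≤ 1 := by
        exact_mod_cast card_pathLists_self_le (G := G) (t := w) (S := S)
      exact h1.trans (one_le_mul_of_one_le_of_one_le (one_le_weight _)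
        (Finset.one_le_prod fun v _ => one_le_b _))
    · have := card_pathLists_le_weight hw hwt fun ε' hε' =>
        ih _ (card_erase_lt_of_mem hw) _ ε' (fun _ => 0) hε' rfl
      have e2 : n w = degIn G S w := by simp [hn, endMark, hwt]
      rw [e2]
      exact this
  -- At most one token per vertex is short, so `μ v ≥ x v - 1` and the powers of `ρ` in the factors
  -- are available.
  have hfac : B * ∏ w ∈ T, factor (n w) (x w) ≤ rho ^ (∑ w ∈ S, μ w) * ∏ v ∈ S, b (n v + x v) := by
    rw [hT, prod_filter, hB, ← prod_pow_eq_pow_sum, ← prod_mul_distrib, ← prod_mul_distrib]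
    refine prod_le_prod (fun v _ => ?_) fun v _ => ?_
    · refine mul_nonneg (b_pos _).le ?_
      split_ifs
      · exact zero_le_one.trans (one_le_factor _ _)
      · exact zero_le_one
    · have hb := b_pos (n v)
      have hb' : b (n v) ≤ b (n v + x v) := b_mono (by omega)
      split_ifs with h
      · have e : b (n v) * factor (n v) (x v) = rho ^ (x v - 1) * b (n v + x v) := by
          unfold factor; field_simp
        rw [e]
        refine mul_le_mul_of_nonneg_right ?_ (b_pos _).le
        refine pow_le_pow_right₀ rho_gt_one.le ?_
        have := hε v
        simp only [hx]
        omega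
      · rw [mul_one]
        exact hb'.trans (le_mul_of_one_le_left (b_pos _).le (one_le_pow₀ rho_gt_one.le))
  have hzero : ∀ w ∈ S, w ∉ T → (x w : ℝ) * (pathLists G t S w).card = 0 := by
    intro w hw hwT
    have h : ¬(1 ≤ x w ∧ 1 ≤ n w) := fun h => hwT (mem_filter.2 ⟨hw, h⟩)
    by_cases h1 : x w = 0
    · simp [h1]
    · have h2 : n w = 0 := by omega
      have h3 : degIn G S w = 0 ∧ w ≠ t := by simpa [hn, endMark] using h2
      rw [pathLists_eq_empty_of_degIn h3.2 h3.1]; simp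
  calc tokenSum G t S x = ∑ w ∈ T, (x w : ℝ) * (pathLists G t S w).card :=
        (sum_subset hTS hzero).symm
    _ ≤ ∑ w ∈ T, (x w : ℝ) * (B * (weight (n w) / b (n w))) :=
        sum_le_sum fun w hw => mul_le_mul_of_nonneg_left (hbound w (hTS hw)) (Nat.cast_nonneg _)
    _ = B * ∑ w ∈ T, (x w : ℝ) * (weight (n w) / b (n w)) := by
        rw [mul_sum]; exact sum_congr rfl fun w _ => by ring
    _ ≤ B * (weight (∑ w ∈ T, x w) * ∏ w ∈ T, factor (n w) (x w)) := by gcongr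
    _ = weight (∑ w ∈ T, x w) * (B * ∏ w ∈ T, factor (n w) (x w)) := by ring
    _ ≤ weight (∑ w ∈ S, x w) * (rho ^ (∑ w ∈ S, μ w) * ∏ v ∈ S, b (n v + x v)) := by
        refine mul_le_mul (weight_mono (sum_le_sum_of_subset hTS)) hfac ?_ (weight_pos _).le
        exact mul_nonneg hBpos.le (prod_nonneg fun w _ => zero_le_one.trans (one_le_factor _ _))
    _ = potential G t S ε μ := rfl

end Paths

/-! ### From paths to cycles -/

theorem degIn_univ {V : Type*} [Fintype V] {G : SimpleGraph V} [DecidableRel G.Adj] (v : V) :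
    degIn G univ v = G.degree v := by
  rw [degIn, ← SimpleGraph.neighborFinset_eq_filter, SimpleGraph.card_neighborFinset_eq_degree]

theorem toSubgraph_eq_of_support_eq {V : Type*} {G : SimpleGraph V} {u v : V}
    {p : G.Walk u u} {q : G.Walk v v}
    (h : p.support = q.support) : p.toSubgraph = q.toSubgraph := by
  have huv : u = v := by
    have h' := h
    rw [← SimpleGraph.Walk.cons_tail_support p, ← SimpleGraph.Walk.cons_tail_support q] at h'
    exact (List.cons.inj h').1
  subst huv
  rw [SimpleGraph.Walk.ext_support h]

theorem support_reverse_ne {V : Type*} {G : SimpleGraph V} {u : V}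
    {p : G.Walk u u} (hp : p.IsCycle) :
    p.reverse.support ≠ p.support := by
  intro h
  have h1 := SimpleGraph.Walk.ext_support h
  have h2 := hp.snd_ne_penultimate
  rw [← SimpleGraph.Walk.snd_reverse, h1] at h2
  exact h2 rfl

section Cycles

variable {V : Type*} [DecidableEq V] {G : SimpleGraph V} [DecidableRel G.Adj]

theorem support_mem_pathLists {w t : V} (q : G.Walk w t) (hq : q.IsPath) {S : Finset V}
    (hS : ∀ v ∈ q.support, v ∈ S) : q.support ∈ pathLists G t S w := by
  induction q generalizing S with
  | nil => rw [pathLists_self (hS _ (by simp))]; simp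
  | @cons u v t h q ih =>
    rw [SimpleGraph.Walk.cons_isPath_iff] at hq
    have hut : u ≠ t := fun e => hq.2 (e ▸ q.end_mem_support)
    rw [pathLists_of_ne (hS _ (by simp)) hut, SimpleGraph.Walk.support_cons]
    have hmem : ∀ y ∈ q.support, y ∈ S.erase u := fun y hy =>
      mem_erase.2 ⟨fun e => hq.2 (e ▸ hy), hS y (by simp [hy])⟩
    refine mem_biUnion.2 ⟨v, mem_filter.2 ⟨hmem v q.start_mem_support, h⟩, ?_⟩
    exact mem_image_of_mem _ (ih hq.1 hmem)

variable [Fintype V]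

variable (G) in
/-- The vertex sequences of closed walks that start with the edge from `t` to `s` and continue
along a path from `s` back to `t`. -/
def cycleLists (t s : V) : Finset (List V) :=
  ((univ.erase s).filter fun y => G.Adj s y ∧ y ≠ t).biUnion fun y =>
    (pathLists G t (univ.erase s) y).image fun l => t :: s :: l

/-- The neighbours of `s` other than `t` get tokens, and `endMark` stands in for the edge from `t`
to `s`; so every argument of `b` is again the full degree. The weight of `deg s - 1` tokens is at
most the missing factor `b (deg s)`. -/
theorem card_cycleLists_le {t s : V} (h : G.Adj t s) :
    ((cycleLists G t s).card : ℝ) ≤ ∏ v, b (G.degree v) := by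
  set ε : V → ℕ := fun y => if G.Adj s y ∧ y ≠ t then 1 else 0 with hε
  have h1 : (cycleLists G t s).card ≤
      ∑ y ∈ (univ.erase s).filter fun y => G.Adj s y ∧ y ≠ t,
        (pathLists G t (univ.erase s) y).card :=
    card_biUnion_le.trans (sum_le_sum fun y _ => card_image_le)
  have h2 := tokenSum_le_potential (G := G) (t := t) (univ.erase s) ε (fun _ => 0)
    (fun v => by simp only [hε]; split_ifs <;> simp)
  have hmark : ∀ v, endMark t v + ε v = if G.Adj s v then 1 else 0 := by
    intro v
    simp only [hε, endMark]
    by_cases hv : v = t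
    · subst hv; simp [h.symm]
    · simp [hv]
  have hdeg : ∀ v ∈ univ.erase s, b (degIn G (univ.erase s) v + endMark t v + (ε v + 0)) =
      b (G.degree v) := by
    intro v _
    rw [add_zero, add_assoc, hmark, degIn_erase_add _ (mem_univ s), degIn_univ]
  have hsum : ∑ v ∈ univ.erase s, (ε v + 0) + 1 = G.degree s := by
    have ht : t ∈ univ.erase s := mem_erase.2 ⟨h.ne, mem_univ t⟩
    have e : ∑ v ∈ univ.erase s, endMark t v = 1 := by
      unfold endMark; rw [sum_ite_eq', if_pos ht]
    rw [← e, ← sum_add_distrib, ← degIn_univ, degIn, ← filter_erase_adj, card_filter]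
    exact sum_congr rfl fun v _ => by rw [← hmark]; ring
  have hw : weight (∑ v ∈ univ.erase s, (ε v + 0)) ≤ b (G.degree s) := by
    rw [← hsum]
    rcases Nat.eq_zero_or_pos (∑ v ∈ univ.erase s, (ε v + 0)) with h0 | h0
    · rw [h0]; simpa [weight] using one_le_b 1
    · exact weight_le_b_succ _ h0
  calc ((cycleLists G t s).card : ℝ) ≤ tokenSum G t (univ.erase s) (fun w => ε w + 0) := by
        refine (Nat.cast_le.2 h1).trans (le_of_eq ?_)
        rw [sum_filter]
        unfold tokenSum
        push_cast
        refine sum_congr rfl fun y _ => ?_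
        simp only [hε]
        split_ifs <;> simp
    _ ≤ _ := h2
    _ = weight (∑ v ∈ univ.erase s, (ε v + 0)) * ∏ v ∈ univ.erase s, b (G.degree v) := by
        unfold potential
        rw [prod_congr rfl hdeg, sum_const_zero, pow_zero, one_mul]
    _ ≤ b (G.degree s) * ∏ v ∈ univ.erase s, b (G.degree v) :=
        mul_le_mul_of_nonneg_right hw (prod_nonneg fun v _ => (b_pos _).le)
    _ = _ := mul_prod_erase univ (fun v => b (G.degree v)) (mem_univ s)

theorem support_mem_cycleLists {t : V} (w : G.Walk t t) (hw : w.IsCycle) :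
    ∃ d : G.Dart, w.support ∈ cycleLists G d.fst d.snd := by
  cases w with
  | nil => exact absurd hw SimpleGraph.Walk.not_isCycle_nil
  | @cons _ s _ h p =>
    refine ⟨⟨(t, s), h⟩, ?_⟩
    rw [SimpleGraph.Walk.cons_isCycle_iff] at hw
    obtain ⟨hp, he⟩ := hw
    cases p with
    | nil => exact absurd rfl h.ne
    | @cons _ y _ h' q =>
      rw [SimpleGraph.Walk.cons_isPath_iff] at hp
      have hyt : y ≠ t := by
        rintro rfl
        exact he (by simp [Sym2.eq_swap])
      refine mem_biUnion.2 ⟨y, mem_filter.2 ⟨mem_erase.2 ⟨h'.ne', mem_univ y⟩, h', hyt⟩, ?_⟩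
      simp only [SimpleGraph.Walk.support_cons]
      refine mem_image_of_mem _ (support_mem_pathLists q hp.1 fun v hv => ?_)
      exact mem_erase.2 ⟨fun e => hp.2 (e ▸ hv), mem_univ v⟩

theorem ncard_cycles_le :
    ((cycles G).ncard : ℝ) ≤ G.edgeFinset.card * ∏ v, b (G.degree v) := by
  set C := (cycles_finite G).toFinset with hC
  set L := (univ : Finset G.Dart).biUnion fun d => cycleLists G d.fst d.snd with hL
  have hL_mem : ∀ {v : V} (p : G.Walk v v), p.IsCycle → p.support ∈ L := fun p hp => by
    obtain ⟨d, hd⟩ := support_mem_cycleLists p hp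
    exact mem_biUnion.2 ⟨d, mem_univ d, hd⟩
  -- Each cycle receives two distinct lists, one per orientation; a list determines its cycle, which
  -- gives the factor `2` that cancels against the `2m` darts.
  have hex : ∀ H : G.Subgraph, ∃ l : Bool → List V, H ∈ C →
      l true ≠ l false ∧ ∀ c, l c ∈ L ∧
        ∃ (v : V) (q : G.Walk v v), q.support = l c ∧ q.toSubgraph = H := by
    intro H
    by_cases hH : H ∈ C
    · obtain ⟨v, w, hw, hwH⟩ := (cycles_finite G).mem_toFinset.1 hH
      refine ⟨fun c => if c then w.support else w.reverse.support, fun _ =>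
        ⟨(support_reverse_ne hw).symm, fun c => ?_⟩⟩
      cases c with
      | true => exact ⟨hL_mem w hw, v, w, rfl, hwH⟩
      | false => exact ⟨hL_mem _ hw.reverse, v, w.reverse, rfl,
          (SimpleGraph.Walk.toSubgraph_reverse w).trans hwH⟩
    · exact ⟨fun _ => [], fun h => absurd h hH⟩
  choose f hf using hex
  have hcard : (C ×ˢ (univ : Finset Bool)).card ≤ L.card := by
    refine card_le_card_of_injOn (fun x => f x.1 x.2) ?_ ?_
    · intro x hx
      exact mem_coe.2 ((hf x.1 (mem_product.1 (mem_coe.1 hx)).1).2 x.2).1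
    · rintro ⟨H, c⟩ hx ⟨H', c'⟩ hx' heq
      obtain ⟨hne, h1⟩ := hf H (mem_product.1 (mem_coe.1 hx)).1
      obtain ⟨-, h1'⟩ := hf H' (mem_product.1 (mem_coe.1 hx')).1
      obtain ⟨-, v, q, hq, hqH⟩ := h1 c
      obtain ⟨-, v', q', hq', hqH'⟩ := h1' c'
      have hHH : H = H' := by
        rw [← hqH, ← hqH']
        exact toSubgraph_eq_of_support_eq (hq.trans (heq.trans hq'.symm))
      subst hHH
      cases c <;> cases c'
      · rfl
      · exact absurd heq.symm hne
      · exact absurd heq hne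
      · rfl
  have hcard2 : 2 * (cycles G).ncard ≤ ∑ d : G.Dart, (cycleLists G d.fst d.snd).card := by
    rw [card_product, card_univ, Fintype.card_bool] at hcard
    rw [Set.ncard_eq_toFinset_card _ (cycles_finite G), mul_comm]
    exact hcard.trans card_biUnion_le
  have h : (2 : ℝ) * (cycles G).ncard ≤ 2 * (G.edgeFinset.card * ∏ v, b (G.degree v)) := by
    calc (2 : ℝ) * (cycles G).ncard ≤ ∑ d : G.Dart, ((cycleLists G d.fst d.snd).card : ℝ) := by
          exact_mod_cast hcard2
      _ ≤ ∑ _d : G.Dart, ∏ v, b (G.degree v) := sum_le_sum fun d _ => card_cycleLists_le d.adj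
      _ = _ := by
          rw [sum_const, card_univ, SimpleGraph.dart_card_eq_twice_card_edges, nsmul_eq_mul]
          push_cast
          ring
  linarith

end Cycles

/-! ### Averaging over the degrees -/

/-- A supporting line of the concave sequence `log b`. Concavity starts only at `2`, as `step 1 =
log rho < step 2`; this is where minimum degree `2` enters. -/
theorem log_b_le {k K : ℕ} (hk : 2 ≤ k) (hK : 2 ≤ K) :
    log (b k) ≤ log (b K) + ((k : ℝ) - K) * step K := by
  have hs : ∀ j, log (b (j + 1)) = log (b j) + step j := fun j => by unfold step; ring
  rcases le_total K k with h | h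
  · induction k, h using Nat.le_induction with
    | base => simp
    | succ k hKk ih =>
      have := ih (hK.trans hKk)
      have := step_le_step hK hKk
      rw [hs]
      push_cast
      linarith
  · revert hk
    induction h using Nat.decreasingInduction with
    | self => simp
    | of_succ k hlt ih =>
      intro hk
      have h1 := ih (by omega)
      have := step_le_step hk (Nat.le_of_lt hlt)
      rw [hs] at h1
      push_cast at h1
      linarith

theorem log_gamma {d : ℝ} (hd : 0 < d) :
    log (gamma d) = 2 / d * (log (b ⌊d⌋₊) + (d - ⌊d⌋₊) * step ⌊d⌋₊) := by
  unfold gamma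
  split_ifs with h
  · rw [log_rpow (b_pos _), h]
    simp
  · have hc : ⌈d⌉₊ = ⌊d⌋₊ + 1 := by
      refine le_antisymm (Nat.ceil_le_floor_add_one d) (Nat.lt_iff_add_one_le.1 ?_)
      refine Nat.lt_ceil.2 (lt_of_le_of_ne (Nat.floor_le hd.le) h)
    rw [log_mul (rpow_pos_of_pos (b_pos _) _).ne' (rpow_pos_of_pos (b_pos _) _).ne',
      log_rpow (b_pos _), log_rpow (b_pos _), hc]
    have hs : log (b (⌊d⌋₊ + 1)) = log (b ⌊d⌋₊) + step ⌊d⌋₊ := by unfold step; ring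
    rw [hs]
    push_cast
    field_simp
    ring

theorem gamma_pos (d : ℝ) : 0 < gamma d := by
  unfold gamma
  have h1 := b_pos ⌊d⌋₊
  have h2 := b_pos ⌈d⌉₊
  split_ifs <;> positivity

theorem prod_b_degree_le {V : Type*} [Fintype V] (G : SimpleGraph V) [DecidableRel G.Adj]
    (hδ : 2 ≤ G.minDegree) :
    ∏ v, b (G.degree v) ≤ gamma (averageDegree G) ^ G.edgeFinset.card := by
  classical
  have hne : Nonempty V := by
    by_contra h
    rw [not_nonempty_iff] at h
    have : G.minDegree = 0 := by simp
    omega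
  have hdeg : ∀ v, 2 ≤ G.degree v := fun v => hδ.trans (G.minDegree_le_degree v)
  have hn : (0 : ℝ) < Fintype.card V := by exact_mod_cast Fintype.card_pos
  set n : ℝ := (Fintype.card V : ℝ)
  set d := averageDegree G with hd
  have hsum : ∑ v, (G.degree v : ℝ) = 2 * G.edgeFinset.card := by
    exact_mod_cast G.sum_degrees_eq_twice_card_edges
  have hnd : ∑ v, (G.degree v : ℝ) = n * d := by
    rw [hd, averageDegree, mul_div_cancel₀ _ hn.ne']
  have hd2 : 2 ≤ d := by
    have h1 : ∑ _v : V, (2 : ℝ) ≤ ∑ v, (G.degree v : ℝ) :=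
      sum_le_sum fun v _ => by exact_mod_cast hdeg v
    rw [hnd, sum_const, card_univ, nsmul_eq_mul] at h1
    exact le_of_mul_le_mul_left h1 hn
  have hK : 2 ≤ ⌊d⌋₊ := Nat.le_floor (by exact_mod_cast hd2)
  have hpos : 0 < ∏ v, b (G.degree v) := prod_pos fun v _ => b_pos _
  rw [← log_le_log_iff hpos (pow_pos (gamma_pos d) _), log_prod fun v _ => (b_pos _).ne',
    log_pow, log_gamma (by linarith)]
  -- The exponent `2 / d` in `gamma` turns `m` edges into `n = 2m / d` vertices.
  have hm : (G.edgeFinset.card : ℝ) * (2 / d) = n := by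
    have : (d : ℝ) ≠ 0 := by linarith
    field_simp
    linarith
  rw [← mul_assoc, hm]
  calc ∑ v, log (b (G.degree v))
      ≤ ∑ v, (log (b ⌊d⌋₊) + ((G.degree v : ℝ) - ⌊d⌋₊) * step ⌊d⌋₊) :=
        sum_le_sum fun v _ => log_b_le (hdeg v) hK
    _ = n * (log (b ⌊d⌋₊) + (d - ⌊d⌋₊) * step ⌊d⌋₊) := by
        rw [sum_add_distrib, ← sum_mul, sum_sub_distrib, hnd]
        simp only [sum_const, card_univ, nsmul_eq_mul]
        ring

end CycleBound

theorem mainTheorem4 {V : Type*} [Fintype V] [DecidableEq V] (G : SimpleGraph V)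
    [DecidableRel G.Adj] (m : ℕ) (hm : G.edgeFinset.card = m) (hδ : 2 ≤ G.minDegree)
    (d : ℝ) (hd : CycleBound.averageDegree G = d) :
    ((CycleBound.cycles G).ncard : ℝ) ≤ (m : ℝ) * CycleBound.gamma d ^ m := by
  subst hm hd
  exact CycleBound.ncard_cycles_le.trans
    (mul_le_mul_of_nonneg_left (CycleBound.prod_b_degree_le G hδ) (Nat.cast_nonneg _))
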